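/- **Setting.** Let $d\ge 1$. Write $\mathbb H^d$ for the real space of $d\times d$ complex Hermitian matrices, $\mathbb H^d_{+}$ and $\mathbb H^d_{++}$ for the positive-semidefinite and positive-definite ones, $\|\cdot\|$ for the $\ell_2$ operator norm, and $\bar{\operatorname{tr}}\,B=\frac1d\sum_j b_{jj}$. For $A\in\mathbb H^d$ with spectral resolution $A=\sum_i\lambda_iP_i$ and a real function $f$ defined on its eigenvalues, $f(A)=\sum_i f(\lambda_i)P_i$. The class $\Phi_d$ consists of the functions $\phi:[0,\infty)\to\mathbb R$ that are either affine or satisfy: (1) $\phi$ is continuous and convex; (2) $\phi$ is twice continuously differentiable on $(0,\infty)$; (3) with $\psi=\phi'$ on $(0,\infty)$, the map $\psi:\mathbb H^d_{++}\to\mathbb H^d$ has at every $A\in\mathbb H^d_{++}$ a Fréchet derivative $\mathsf D\psi(A)$ that is an invertible linear operator on $\mathbb H^d$, and $A\mapsto[\mathsf D\psi(A)]^{-1}$ is concave on $\mathbb H^d_{++}$ in the semidefinite order of operators on $\mathbb H^d$ with the inner product $\langle A,B\rangle=\bar{\operatorname{tr}}(AB)$. Let $\Phi_\infty=\bigcap_{d\ge1}\Phi_d$.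 Let $X_1,\dots,X_n$ be independent random variables with values in a Polish space, and let $(X_1',\dots,X_n')$ be an independent copy of $(X_1,\dots,X_n)$. Let $Z=Z(X_1,\dots,X_n)\in\mathbb H^d_+$ be a measurable function of $(X_1,\dots,X_n)$, and $$Z_i'=Z(X_1,\dots,X_{i-1},X_i',X_{i+1},\dots,X_n).$$ Let $\phi\in\Phi_\infty$, assume $\mathbb E\|Z\|<\infty$ and $\mathbb E\|\phi(Z)\|<\infty$, and put $$H_\phi(Z)=\mathbb E\,\bar{\operatorname{tr}}\,\phi(Z)-\bar{\operatorname{tr}}\,\phi(\mathbb E Z).$$ Write $\psi=\phi'$, where $\psi(0)$ is the one-sided derivative of $\phi$ at $0$ when it exists (as a finite number). **Corollary (entropy bounds via exchangeability).** (a) If $\phi$ has a finite one-sided derivative at $0$, or if $Z$ is almost surely positive definite, then for each $i$ the variable $\bar{\operatorname{tr}}[(Z-Z_i')(\psi(Z)-\psi(Z_i'))]$ is almost surely nonnegative, and $$H_\phi(Z)\le\frac12\sum_{i=1}^n\mathbb E\,\bar{\operatorname{tr}}\big[(Z-Z_i')(\psi(Z)-\psi(Z_i'))\big],$$ where the expectations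 take values in $[0,\infty]$. (b) In all cases, even if $\phi'(0+)=-\infty$ and $Z$ may be singular, $$H_\phi(Z)\le\frac12\sum_{i=1}^n\mathbb E\,\Big(\liminf_{\varepsilon\downarrow0}\ \bar{\operatorname{tr}}\big[(Z-Z_i')(\psi(Z+\varepsilon\mathbf I)-\psi(Z_i'+\varepsilon\mathbf I))\big]\Big),$$ where the trace on the right is nonnegative and the limit inferior and the expectations take values in $[0,\infty]$. -/

import Mathlib

open MeasureTheory ProbabilityTheory Filter Topology
open scoped ENNReal ComplexOrder

namespace MatrixEntropy

/-- The matrix algebra `𝕄^d` of `d × d` complex matrices. -/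
abbrev Mat (d : ℕ) : Type := Matrix (Fin d) (Fin d) ℂ

/-- The standard matrix function `f(A) = ∑ f(λᵢ) Pᵢ` of a Hermitian matrix `A`. Only the values
of `f` on the spectrum of `A` matter; every `f` is continuous on this finite set. -/
noncomputable def stdFun {d : ℕ} (f : ℝ → ℝ) (A : Mat d) : Mat d := cfc f A

/-- The (real part of the) normalized trace `(1/d) ∑ⱼ bⱼⱼ`. It is applied below only to Hermitian
matrices and to products of two Hermitian matrices, whose traces are real. -/
noncomputable def ntr {d : ℕ} (B : Mat d) : ℝ := (B.trace).re / d

/-- The derivative `ψ = φ'` of a function `φ` on `[0, ∞)`. At `0` it is the one-sided derivative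
(and a junk value if `φ` has no finite one-sided derivative there). -/
noncomputable def psi (φ : ℝ → ℝ) : ℝ → ℝ := fun t => derivWithin φ (Set.Ici 0) t

open scoped Matrix.Norms.L2Operator

/-- The real vector space `ℍ^d` of Hermitian matrices, with the `ℓ₂` operator norm. -/
abbrev Herm (d : ℕ) : Type := selfAdjoint.submodule ℝ (Mat d)

/-- The set `ℍ^d₊₊` of positive-definite matrices. -/
def posDefSet (d : ℕ) : Set (Herm d) := {A | (A : Mat d).PosDef}

/-- A standard matrix function as a map on Hermitian matrices. -/
noncomputable def liftHerm (d : ℕ) (f : ℝ → ℝ) (A : Herm d) : Herm d :=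
  ⟨stdFun f (A : Mat d), cfc_predicate f (A : Mat d)⟩

/-- The normalized trace inner product on Hermitian matrices. -/
noncomputable def trInner {d : ℕ} (A B : Herm d) : ℝ := ntr ((A : Mat d) * (B : Mat d))

/-- The class `Φ_d`: functions on `[0, ∞)` (encoded as functions on `ℝ` of which only the
restriction to `[0, ∞)` is used) that are affine, or else are continuous and convex on `[0, ∞)`,
are `C²` on `(0, ∞)`, and are such that the Fréchet derivative of the standard matrix function
`ψ = φ'` is an invertible operator at each positive-definite `A`, its inverse being a concave
function of `A` for the semidefinite order of operators. The latter says that each quadratic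
form `A ↦ ⟨K, [Dψ(A)]⁻¹ K⟩` is concave. -/
def MemPhi (d : ℕ) (φ : ℝ → ℝ) : Prop :=
  (∃ a b : ℝ, ∀ t ∈ Set.Ici (0 : ℝ), φ t = a * t + b) ∨
  (ContinuousOn φ (Set.Ici 0) ∧ ConvexOn ℝ (Set.Ici 0) φ ∧
    ContDiffOn ℝ 2 φ (Set.Ioi 0) ∧
    (∀ A ∈ posDefSet d, DifferentiableAt ℝ (liftHerm d (psi φ)) A ∧
      (fderiv ℝ (liftHerm d (psi φ)) A).IsInvertible) ∧
    (∀ K : Herm d, ConcaveOn ℝ (posDefSet d)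
      (fun A => trInner K ((fderiv ℝ (liftHerm d (psi φ)) A).inverse K))))

/-- The class of matrix entropies `Φ_∞ = ⋂_{d ≥ 1} Φ_d`. -/
def MemPhiInfty (φ : ℝ → ℝ) : Prop := ∀ d : ℕ, 1 ≤ d → MemPhi d φ

/-- The matrix `φ`-entropy `H_φ(Z) = E tr φ(Z) - tr φ(E Z)` (normalized traces). -/
noncomputable def entropy {Ω : Type*} [MeasurableSpace Ω] {d : ℕ} (φ : ℝ → ℝ) (P : Measure Ω)
    (Z : Ω → Mat d) : ℝ :=
  (∫ ω, ntr (stdFun φ (Z ω)) ∂P) - ntr (stdFun φ (∫ ω, Z ω ∂P))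

/-- The quantity `tr [(A - B) (ψ(A) - ψ(B))]` (normalized trace) for `ψ = φ'`. -/
noncomputable def dirichlet {d : ℕ} (φ : ℝ → ℝ) (A B : Mat d) : ℝ :=
  ntr ((A - B) * (stdFun (psi φ) A - stdFun (psi φ) B))

/-- The extension of `dirichlet` to all pairs of positive-semidefinite matrices, with values in
`[0, ∞]`, also when `φ'(0+) = -∞`: the eigenvalues in the argument of `ψ` are shifted by `ε > 0`,
and `ε` decreases to zero. -/
noncomputable def dirichletExt {d : ℕ} (φ : ℝ → ℝ) (A B : Mat d) : ℝ≥0∞ :=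
  liminf (fun ε : ℝ => ENNReal.ofReal
    (ntr ((A - B) * (stdFun (psi φ) (A + (ε : ℂ) • (1 : Mat d))
      - stdFun (psi φ) (B + (ε : ℂ) • (1 : Mat d)))))) (𝓝[>] (0 : ℝ))

end MatrixEntropy

open scoped Matrix.Norms.L2Operator

namespace MatrixEntropy

/-! ### Normalized traces, double spectral sums and Klein's inequality. -/

variable {d : ℕ}

/-! Everything rests on the Bregman divergence Br of tr φ. Concavity of [Dψ]⁻¹ makes the Hessian
form of tr φ jointly convex in base point and direction (`hessian_combo_le`). Hence Jensen gaps, and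
in the limit Br itself, are jointly convex (`MemPhi.convexOn_bregman`). Jensen's inequality for the
divergence of Z from a partial mean then gives two-variable subadditivity of entropy
(`IsEntropyPotential.integral_section_add_le`), and induction on n reduces the claim to one variable
(`IsEntropyPotential.ofReal_entropy_pi_le`).

For one variable T with independent copy T', E Br(T, B) = H(T) + Br(E T, B) ≥ H(T) for every fixed
B. Taking B = T' and adding the mirrored bound produces the symmetrized divergence, which is tr[(T -
T')(ψ(T) - ψ(T'))] (`truncDirichlet_eq`).

Since ψ may blow up at 0, the one-variable step is run with φ replaced below δ by its tangent line.
The truncated form is continuous on all Hermitian pairs and lies below the true one wherever ψ is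
monotone. The truncation costs at most 2 * `truncError φ δ` per variable, which vanishes as δ ↓ 0.
Subadditivity keeps the original φ, because the truncation need not belong to Φ_d. -/

theorem ntr_add (A B : Mat d) : ntr (A + B) = ntr A + ntr B := by
  simp [ntr, Matrix.trace_add, add_div]

theorem ntr_sub (A B : Mat d) : ntr (A - B) = ntr A - ntr B := by
  simp [ntr, Matrix.trace_sub, sub_div]

theorem ntr_smul (c : ℝ) (A : Mat d) : ntr (c • A) = c * ntr A := by
  simp [ntr, Matrix.trace_smul, mul_div_assoc]

theorem ntr_mul_comm (A B : Mat d) : ntr (A * B) = ntr (B * A) := by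
  simp [ntr, Matrix.trace_mul_comm A B]

/-- The normalized trace as a real linear functional. -/
noncomputable def ntrₗ (d : ℕ) : Mat d →ₗ[ℝ] ℝ where
  toFun := ntr
  map_add' := ntr_add
  map_smul' c A := by simpa using ntr_smul c A

theorem continuous_ntr : Continuous (ntr : Mat d → ℝ) :=
  (ntrₗ d).continuous_of_finiteDimensional

/-- The double spectral resolution of the trace of a product of functions of two Hermitian
matrices. -/
theorem exists_double_spectral_sum {A B : Mat d} (hA : A.IsHermitian) (hB : B.IsHermitian) :
    ∃ (a b : Fin d → ℝ) (w : Fin d → Fin d → ℝ), (∀ i j, 0 ≤ w i j) ∧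
      (∀ i, a i ∈ spectrum ℝ A) ∧ (∀ j, b j ∈ spectrum ℝ B) ∧
      ∀ f g : ℝ → ℝ, ntr (stdFun f A * stdFun g B) = ∑ i, ∑ j, w i j * (f (a i) * g (b j)) := by
  set U : Mat d := (hA.eigenvectorUnitary : Mat d) with hU
  set V : Mat d := (hB.eigenvectorUnitary : Mat d) with hV
  -- The weights |⟨uᵢ, vⱼ⟩|² / d come from the two eigenbases and do not depend on `f` and `g`, so
  -- scalar inequalities can be summed against them.
  refine ⟨hA.eigenvalues, hB.eigenvalues, fun i j => Complex.normSq ((star U * V) i j) / d,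
    fun i j => div_nonneg (Complex.normSq_nonneg _) (Nat.cast_nonneg _), fun i => ?_, fun j => ?_,
    fun f g => ?_⟩
  · rw [hA.spectrum_real_eq_range_eigenvalues]; exact ⟨i, rfl⟩
  · rw [hB.spectrum_real_eq_range_eigenvalues]; exact ⟨j, rfl⟩
  · have h1 : stdFun f A = U * Matrix.diagonal (fun i => (f (hA.eigenvalues i) : ℂ)) * star U := by
      rw [stdFun, hA.cfc_eq, Matrix.IsHermitian.cfc, Unitary.conjStarAlgAut_apply]; rfl
    have h2 : stdFun g B = V * Matrix.diagonal (fun i => (g (hB.eigenvalues i) : ℂ)) * star V := by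
      rw [stdFun, hB.cfc_eq, Matrix.IsHermitian.cfc, Unitary.conjStarAlgAut_apply]; rfl
    set W : Mat d := star U * V with hW
    have h3 : (stdFun f A * stdFun g B).trace =
        (Matrix.diagonal (fun i => (f (hA.eigenvalues i) : ℂ)) * W *
          (Matrix.diagonal (fun i => (g (hB.eigenvalues i) : ℂ)) * star W)).trace := by
      rw [h1, h2, Matrix.mul_assoc, Matrix.mul_assoc, Matrix.trace_mul_comm]
      simp only [hW, star_mul, star_star, Matrix.mul_assoc]
    have h4 : (stdFun f A * stdFun g B).trace = ((∑ i, ∑ j,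
        Complex.normSq (W i j) * (f (hA.eigenvalues i) * g (hB.eigenvalues j)) : ℝ) : ℂ) := by
      rw [h3, Matrix.trace]
      push_cast
      refine Finset.sum_congr rfl fun i _ => ?_
      rw [Matrix.diag_apply, Matrix.mul_apply]
      refine Finset.sum_congr rfl fun j _ => ?_
      rw [Matrix.diagonal_mul, Matrix.diagonal_mul, Matrix.star_apply,
        Complex.normSq_eq_conj_mul_self]
      simp only [RCLike.star_def]
      ring
    rw [ntr, h4, Complex.ofReal_re, Finset.sum_div]
    refine Finset.sum_congr rfl fun i _ => ?_
    rw [Finset.sum_div]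
    refine Finset.sum_congr rfl fun j _ => ?_
    ring

theorem stdFun_id {A : Mat d} (hA : A.IsHermitian) : stdFun (fun t => t) A = A :=
  cfc_id' ℝ A (ha := hA)

theorem stdFun_one {A : Mat d} (hA : A.IsHermitian) : stdFun (fun _ => 1) A = 1 :=
  cfc_const_one ℝ A (ha := hA)

theorem stdFun_congr {A : Mat d} {f g : ℝ → ℝ} (h : ∀ t ∈ spectrum ℝ A, f t = g t) :
    stdFun f A = stdFun g A :=
  cfc_congr h

theorem continuousOn_spectrum (f : ℝ → ℝ) (A : Mat d) : ContinuousOn f (spectrum ℝ A) :=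
  (Matrix.finite_real_spectrum (A := A)).continuousOn f

theorem spectrum_nonneg {A : Mat d} (hA : A.PosSemidef) {t : ℝ} (ht : t ∈ spectrum ℝ A) :
    0 ≤ t := by
  rw [hA.1.spectrum_real_eq_range_eigenvalues] at ht
  obtain ⟨i, rfl⟩ := ht
  exact hA.eigenvalues_nonneg i

theorem spectrum_pos {A : Mat d} (hA : A.PosDef) {t : ℝ} (ht : t ∈ spectrum ℝ A) :
    0 < t := by
  rw [hA.1.spectrum_real_eq_range_eigenvalues] at ht
  obtain ⟨i, rfl⟩ := ht
  exact hA.eigenvalues_pos i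

theorem mul_stdFun {A : Mat d} (hA : A.IsHermitian) (f : ℝ → ℝ) :
    A * stdFun f A = stdFun (fun t => t * f t) A :=
  (congrArg (· * stdFun f A) (stdFun_id hA)).symm.trans
    (cfc_mul (fun t => t) f A (continuousOn_spectrum _ _) (continuousOn_spectrum _ _)).symm

/-- The trace form of the subgradient inequality (Klein's inequality). -/
theorem klein {A B : Mat d} (hA : A.IsHermitian) (hB : B.IsHermitian) {s t : Set ℝ}
    (hs : spectrum ℝ A ⊆ s) (ht : spectrum ℝ B ⊆ t) {f g : ℝ → ℝ}
    (hle : ∀ a ∈ s, ∀ b ∈ t, f b + g b * (a - b) ≤ f a) :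
    ntr (stdFun f B) + ntr (stdFun g B * (A - B)) ≤ ntr (stdFun f A) := by
  obtain ⟨a, b, w, hw, ha, hb, hsum⟩ := exists_double_spectral_sum hA hB
  have e1 := hsum (fun _ => 1) f
  have e2 := hsum f (fun _ => 1)
  have e3 := hsum (fun t => t) g
  have e4 := hsum (fun _ => 1) (fun t => t * g t)
  rw [stdFun_one hA, one_mul] at e1
  rw [stdFun_one hB, mul_one] at e2
  rw [stdFun_id hA, ntr_mul_comm] at e3
  rw [stdFun_one hA, one_mul, ← mul_stdFun hB, ntr_mul_comm] at e4
  rw [mul_sub, ntr_sub, e1, e2, e3, e4]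
  simp only [← Finset.sum_sub_distrib, ← Finset.sum_add_distrib]
  refine Finset.sum_le_sum fun i _ => Finset.sum_le_sum fun j _ => ?_
  have := mul_le_mul_of_nonneg_left (hle _ (hs (ha i)) _ (ht (hb j))) (hw i j)
  linarith

/-- Each side is the weighted sum of (aᵢ - bⱼ)(f(aᵢ) - f(bⱼ)) over pairs of eigenvalues, so the
scalar inequality suffices and no operator monotonicity is needed. -/
theorem ntr_sub_mul_sub_le {A B : Mat d} (hA : A.IsHermitian) (hB : B.IsHermitian) {s : Set ℝ}
    (hs : spectrum ℝ A ⊆ s) (ht : spectrum ℝ B ⊆ s) {f g : ℝ → ℝ}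
    (hle : ∀ a ∈ s, ∀ b ∈ s, (a - b) * (f a - f b) ≤ (a - b) * (g a - g b)) :
    ntr ((A - B) * (stdFun f A - stdFun f B)) ≤ ntr ((A - B) * (stdFun g A - stdFun g B)) := by
  obtain ⟨a, b, w, hw, ha, hb, hsum⟩ := exists_double_spectral_sum hA hB
  have e : ∀ f : ℝ → ℝ, ntr ((A - B) * (stdFun f A - stdFun f B)) =
      ∑ i, ∑ j, w i j * ((a i - b j) * (f (a i) - f (b j))) := fun f => by
    have h1 := hsum (fun t => t * f t) (fun _ => 1)
    have h2 := hsum (fun t => t) f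
    have h3 := hsum f (fun t => t)
    have h4 := hsum (fun _ => 1) (fun t => t * f t)
    rw [stdFun_one hB, mul_one, ← mul_stdFun hA] at h1
    rw [stdFun_id hA] at h2
    rw [stdFun_id hB, ntr_mul_comm] at h3
    rw [stdFun_one hA, one_mul, ← mul_stdFun hB] at h4
    rw [sub_mul, mul_sub, mul_sub, ntr_sub, ntr_sub, ntr_sub, h1, h2, h3, h4]
    simp only [← Finset.sum_sub_distrib]
    exact Finset.sum_congr rfl fun i _ => Finset.sum_congr rfl fun j _ => by ring
  rw [e, e]
  exact Finset.sum_le_sum fun i _ => Finset.sum_le_sum fun j _ =>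
    mul_le_mul_of_nonneg_left (hle _ (hs (ha i)) _ (ht (hb j))) (hw i j)

theorem continuous_stdFun {f : ℝ → ℝ} (hf : Continuous f) :
    Continuous (fun A : Herm d => stdFun f (A : Mat d)) :=
  Continuous.cfc_of_mem_nhdsSet (A := Mat d) (s := Set.univ) (p := IsSelfAdjoint) f
    Filter.univ_mem continuous_subtype_val (fun A => A.2) hf.continuousOn

theorem abs_ntr_le (A : Mat d) : |ntr A| ≤ ‖A‖ := by
  have h1 : ∀ i, ‖A i i‖ ≤ ‖A‖ := fun i => by
    have h := Matrix.l2_opNorm_mulVec A (EuclideanSpace.single i (1 : ℂ))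
    have h2 := PiLp.norm_apply_le (p := 2)
      (WithLp.toLp 2 (A.mulVec (EuclideanSpace.single i (1 : ℂ)).ofLp)) i
    simp at h h2
    exact h2.trans h
  rcases Nat.eq_zero_or_pos d with rfl | hd
  · simp [ntr]
  rw [ntr, abs_div, Nat.abs_cast, div_le_iff₀ (by exact_mod_cast hd)]
  calc |A.trace.re| ≤ ‖A.trace‖ := Complex.abs_re_le_norm _
    _ ≤ ∑ i, ‖A i i‖ := norm_sum_le _ _
    _ ≤ ∑ _i : Fin d, ‖A‖ := Finset.sum_le_sum fun i _ => h1 i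
    _ = ‖A‖ * d := by simp [mul_comm]

/-! ### Scalar convexity: tangent lines and monotone derivative. -/

/-- The regularity shared by all members of the classes `Φ_d`, affine or not. -/
structure IsRegularConvex (φ : ℝ → ℝ) : Prop where
  continuousOn : ContinuousOn φ (Set.Ici 0)
  convexOn : ConvexOn ℝ (Set.Ici 0) φ
  contDiffOn : ContDiffOn ℝ 2 φ (Set.Ioi 0)

theorem MemPhi.isRegularConvex {φ : ℝ → ℝ} (h : MemPhi d φ) : IsRegularConvex φ := by
  rcases h with ⟨a, b, h⟩ | ⟨h1, h2, h3, -⟩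
  · have hc : ConvexOn ℝ (Set.Ici (0 : ℝ)) (fun t => a * t + b) :=
      ⟨convex_Ici 0, fun x _ y _ s t _ _ hst => by
        simp only [smul_eq_mul]; apply le_of_eq; linear_combination (-b) * hst⟩
    refine ⟨?_, ?_, ?_⟩
    · exact ContinuousOn.congr (by fun_prop) h
    · exact hc.congr fun t ht => (h t ht).symm
    · exact ContDiffOn.congr (f := fun t => a * t + b) (by fun_prop)
        fun t ht => h t (Set.mem_Ici.2 (le_of_lt ht))
  · exact ⟨h1, h2, h3⟩

namespace IsRegularConvex

variable {φ : ℝ → ℝ} (h : IsRegularConvex φ)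
include h

theorem hasDerivAt {t : ℝ} (ht : 0 < t) : HasDerivAt φ (psi φ t) t := by
  have h1 : DifferentiableAt ℝ φ t :=
    (h.contDiffOn.differentiableOn (by norm_num)).differentiableAt (Ioi_mem_nhds ht)
  rw [psi, derivWithin_of_mem_nhds (Ici_mem_nhds ht)]
  exact h1.hasDerivAt

theorem continuousOn_psi : ContinuousOn (psi φ) (Set.Ioi 0) := by
  have h1 : ContinuousOn (deriv φ) (Set.Ioi 0) :=
    h.contDiffOn.continuousOn_deriv_of_isOpen isOpen_Ioi (by norm_num)
  exact h1.congr fun t ht => (h.hasDerivAt ht).deriv.symm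

/-- The point of tangency stays in (0, ∞) because φ'(0+) may be -∞; the comparison point may be 0.
-/
theorem tangent_le {a b : ℝ} (ha : 0 ≤ a) (hb : 0 < b) : φ b + psi φ b * (a - b) ≤ φ a := by
  rcases lt_trichotomy a b with hab | rfl | hab
  · have := h.convexOn.slope_le_of_hasDerivAt ha (Set.mem_Ici.2 hb.le) hab (h.hasDerivAt hb)
    rw [slope_def_field, div_le_iff₀ (sub_pos.2 hab)] at this
    linarith
  · simp
  · have := h.convexOn.le_slope_of_hasDerivAt (Set.mem_Ici.2 hb.le) ha hab (h.hasDerivAt hb)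
    rw [slope_def_field, le_div_iff₀ (sub_pos.2 hab)] at this
    linarith

theorem monotoneOn_psi : MonotoneOn (psi φ) (Set.Ioi 0) := by
  intro a ha b hb hab
  rcases hab.eq_or_lt with rfl | hab
  · rfl
  have h1 := h.tangent_le (le_of_lt ha) hb
  have h2 := h.tangent_le (le_of_lt hb) ha
  nlinarith

end IsRegularConvex

/-! ### The trace potential and its gradient on Hermitian matrices. -/

/-- The trace function `A ↦ tr f(A)` (normalized trace) on Hermitian matrices. -/
noncomputable def trFun (f : ℝ → ℝ) (A : Herm d) : ℝ := ntr (stdFun f (A : Mat d))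

/-- The trace inner product as a continuous bilinear form. -/
noncomputable def trForm (d : ℕ) : Herm d →L[ℝ] Herm d →L[ℝ] ℝ :=
  (LinearMap.mk₂ ℝ (trInner (d := d))
    (fun A B C => by simp [trInner, add_mul, ntr_add])
    (fun c A B => by simp [trInner, ← ntr_smul])
    (fun A B C => by simp [trInner, mul_add, ntr_add])
    (fun c A B => by simp [trInner, ← ntr_smul])).toContinuousBilinearMap

theorem trForm_apply (A B : Herm d) : trForm d A B = trInner A B := rfl

theorem trInner_comm (A B : Herm d) : trInner A B = trInner B A := ntr_mul_comm _ _

theorem isHermitian_coe (A : Herm d) : (A : Mat d).IsHermitian := A.2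

theorem mem_posDefSet_iff {A : Herm d} :
    A ∈ posDefSet d ↔ spectrum ℝ (A : Mat d) ⊆ Set.Ioi 0 := by
  refine ⟨fun h t ht => spectrum_pos h ht, fun h => ?_⟩
  refine (isHermitian_coe A).posDef_iff_eigenvalues_pos.2 fun i => h ?_
  rw [(isHermitian_coe A).spectrum_real_eq_range_eigenvalues]
  exact ⟨i, rfl⟩

theorem isOpen_posDefSet : IsOpen (posDefSet d) := by
  have h := ((upperHemicontinuous_spectrum ℝ (Mat d)).isOpen (Set.Ioi 0)).preimage
    (continuous_subtype_val (p := fun A : Mat d => A ∈ selfAdjoint.submodule ℝ (Mat d)))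
  convert! h using 1
  ext A
  rw [mem_posDefSet_iff, Set.mem_preimage, Set.mem_ofPred_eq, isOpen_Ioi.mem_nhdsSet]

theorem convex_posDefSet : Convex ℝ (posDefSet d) := by
  intro A hA B hB a b ha hb hab
  rcases ha.eq_or_lt with rfl | ha
  · simpa [show b = 1 by linarith] using hB
  · have h1 : ((a • A : Herm d) : Mat d).PosDef := by
      simpa using Matrix.PosDef.smul hA ha
    have h2 : ((b • B : Herm d) : Mat d).PosSemidef := by
      simpa using Matrix.PosSemidef.smul (Matrix.PosDef.posSemidef hB) hb
    exact h1.add_posSemidef h2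

variable {φ : ℝ → ℝ}

/-- Klein's inequality, read as saying that ψ(B) is a subgradient of tr φ at B. This is the link
through which the generic calculus below applies to tr φ. -/
theorem IsRegularConvex.trace_tangent_le (h : IsRegularConvex φ) {A B : Herm d}
    (hA : (A : Mat d).PosSemidef) (hB : B ∈ posDefSet d) :
    trFun φ B + trForm d (liftHerm d (psi φ) B) (A - B) ≤ trFun φ A :=
  klein A.2 B.2 (s := Set.Ici 0) (t := Set.Ioi 0) (fun _ ht => spectrum_nonneg hA ht)
    (fun _ ht => spectrum_pos hB ht) fun _ ha _ hb => h.tangent_le ha hb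

theorem continuousOn_liftHerm {f : ℝ → ℝ} (hf : ContinuousOn f (Set.Ioi 0)) :
    ContinuousOn (liftHerm d f) (posDefSet d) := by
  rw [Topology.IsInducing.subtypeVal.continuousOn_iff]
  refine ContinuousOn.cfc_of_mem_nhdsSet (A := Mat d) (s := Set.Ioi 0) (p := IsSelfAdjoint) f
    ?_ continuous_subtype_val.continuousOn (fun A _ => A.2) hf
  rw [isOpen_Ioi.mem_nhdsSet]
  exact Set.iUnion₂_subset fun A hA => mem_posDefSet_iff.1 hA

/-! ### Second-order calculus of a potential known through its tangent inequality. -/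

section Generic

variable {E : Type*} [NormedAddCommGroup E] [NormedSpace ℝ E] {β : E →L[ℝ] E →L[ℝ] ℝ}
  {U : Set E} {f : E → ℝ} {ψ : E → E}

/-- The tangent inequalities at A and at B squeeze the remainder between 0 and β(ψ(B) - ψ(A))(B -
A), which is o(‖B - A‖) by continuity of ψ. The functional calculus is never differentiated. -/
theorem hasFDerivAt_of_tangent_le (hU : IsOpen U)
    (htan : ∀ A ∈ U, ∀ B ∈ U, f B + β (ψ B) (A - B) ≤ f A) (hψ : ContinuousOn ψ U) {A : E}
    (hA : A ∈ U) : HasFDerivAt f (β (ψ A)) A := by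
  rw [hasFDerivAt_iff_isLittleO, Asymptotics.isLittleO_iff]
  intro c hc
  have hcont : ContinuousAt (fun B => β (ψ B)) A :=
    β.continuous.continuousAt.comp
      (hψ.continuousAt (hU.mem_nhds hA))
  filter_upwards [hU.mem_nhds hA,
    hcont.preimage_mem_nhds (Metric.closedBall_mem_nhds _ hc)] with B hB hBc
  have h1 := htan B hB A hA
  have h2 := htan A hA B hB
  rw [← neg_sub B A, map_neg] at h2
  rw [Set.mem_preimage, Metric.mem_closedBall, dist_eq_norm] at hBc
  have h3 := ((β (ψ B) -
    β (ψ A)).le_opNorm (B - A)).trans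
      (mul_le_mul_of_nonneg_right hBc (norm_nonneg _))
  refine le_trans ?_ h3
  rw [sub_apply, Real.norm_eq_abs, Real.norm_eq_abs]
  refine (abs_le_abs_of_nonneg ?_ ?_) <;> linarith

section SecondOrder

variable (hU : IsOpen U) (htan : ∀ A ∈ U, ∀ B ∈ U, f B + β (ψ B) (A - B) ≤ f A)
  (hdiff : ∀ A ∈ U, DifferentiableAt ℝ ψ A)
include hU htan hdiff

/-- Since β ∘ ψ is the derivative of f, this is the symmetry of second derivatives; symmetry of β
plays no part. -/
theorem hessian_comm {A : E} (hA : A ∈ U) (K L : E) :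
    β (fderiv ℝ ψ A K) L = β (fderiv ℝ ψ A L) K := by
  have h1 : HasFDerivAt (fun B => β (ψ B))
      (β.comp (fderiv ℝ ψ A)) A :=
    (ContinuousLinearMap.hasFDerivAt (𝕜 := ℝ) (E := E) (F := E →L[ℝ] ℝ)
      β).comp A (hdiff A hA).hasFDerivAt
  exact second_derivative_symmetric_of_eventually (𝕜 := ℝ) (f := f)
    (mem_of_superset (hU.mem_nhds hA) fun B hB => hasFDerivAt_of_tangent_le hU htan
      (fun A hA => (hdiff A hA).continuousAt.continuousWithinAt) hB)
    h1 K L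

theorem hasDerivAt_potential_line {A K : E} {s : ℝ} (hs : A + s • K ∈ U) :
    HasDerivAt (fun s : ℝ => f (A + s • K))
      (β (ψ (A + s • K)) K) s := by
  have h1 : HasDerivAt (fun s : ℝ => A + s • K) K s := by
    simpa using ((hasDerivAt_id s).smul_const K).const_add A
  exact (hasFDerivAt_of_tangent_le hU htan (fun A hA =>
    (hdiff A hA).continuousAt.continuousWithinAt) hs).comp_hasDerivAt s h1

omit hU htan in
theorem hasDerivAt_gradient_line {A K : E} {s : ℝ} (hs : A + s • K ∈ U) :
    HasDerivAt (fun s : ℝ => β (ψ (A + s • K)) K)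
      (β (fderiv ℝ ψ (A + s • K) K) K) s := by
  have h1 : HasDerivAt (fun s : ℝ => A + s • K) K s := by
    simpa using ((hasDerivAt_id s).smul_const K).const_add A
  have h2 := (hdiff _ hs).hasFDerivAt.comp_hasDerivAt s h1
  exact ((β.flip K).hasFDerivAt.comp_hasDerivAt s h2)

/-- Adding the tangent inequalities at A and A + sK shows that the gradient is monotone along K; the
difference quotients at s ↓ 0 are therefore nonnegative. -/
theorem hessian_nonneg {A : E} (hA : A ∈ U) (K : E) :
    0 ≤ β (fderiv ℝ ψ A K) K := by
  have h1 := hasDerivAt_gradient_line (β := β) hdiff (A := A) (K := K) (s := 0) (by simpa using hA)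
  simp only [zero_smul, add_zero] at h1
  have h2 := h1.tendsto_slope_zero_right
  refine ge_of_tendsto h2 ?_
  have h3 : ∀ᶠ s : ℝ in 𝓝 0, A + s • K ∈ U := by
    have : ContinuousAt (fun s : ℝ => A + s • K) 0 := by fun_prop
    exact this.eventually (hU.mem_nhds (by simpa using hA))
  filter_upwards [self_mem_nhdsWithin, nhdsWithin_le_nhds h3] with s hs hsA
  have hs : 0 < s := hs
  have h4 := htan _ hsA _ hA
  have h5 := htan _ hA _ hsA
  simp only [add_sub_cancel_left, sub_add_cancel_left, map_neg, map_smul, smul_eq_mul] at h4 h5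
  simp only [zero_add, smul_eq_mul, zero_smul, add_zero]
  have : 0 ≤ s * (β (ψ (A + s • K)) K -
      β (ψ A) K) := by linarith
  exact mul_nonneg (inv_nonneg.2 hs.le) (nonneg_of_mul_nonneg_right this hs)

/-- Concavity of `A ↦ [Dψ(A)]⁻¹` makes the Hessian form of `tr φ` jointly convex. -/
theorem hessian_combo_le (hUc : Convex ℝ U)
    (hinv : ∀ A ∈ U, (fderiv ℝ ψ A).IsInvertible)
    (hconc : ∀ K : E, ConcaveOn ℝ (U)
      (fun A => β K ((fderiv ℝ ψ A).inverse K)))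
    {A C : E} (hA : A ∈ U) (hC : C ∈ U) (K L : E) {a b : ℝ}
    (ha : 0 ≤ a) (hb : 0 ≤ b) (hab : a + b = 1) :
    β (fderiv ℝ ψ (a • A + b • C) (a • K + b • L)) (a • K + b • L) ≤
      a * β (fderiv ℝ ψ A K) K +
        b * β (fderiv ℝ ψ C L) L := by
  have hN := hUc hA hC ha hb hab
  set D := fun A => fderiv ℝ ψ A with hD
  set v := D (a • A + b • C) (a • K + b • L) with hv
  -- Duality for quadratic forms: expand the Hessian form at K - D⁻¹v. The left side is linear in K
  -- minus a concave function of A, hence jointly convex, and the choice of `v` gives equality at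
  -- the combined point and direction.
  have h1 : ∀ A ∈ U, ∀ K, 2 * β v K - β v ((D A).inverse v) ≤
      β (D A K) K := by
    intro A hA K
    have hn := hessian_nonneg hU htan hdiff hA (K - (D A).inverse v)
    have hi : D A ((D A).inverse v) = v := (hinv A hA).self_apply_inverse v
    have hs := hessian_comm hU htan hdiff hA K ((D A).inverse v)
    change 0 ≤ β (D A (K - (D A).inverse v)) (K - (D A).inverse v) at hn
    change β (D A K) _ = β (D A _) K at hs
    rw [hi] at hs
    have e : D A (K - (D A).inverse v) = D A K - v := by rw [map_sub, hi]
    rw [e, map_sub, map_sub, sub_apply, sub_apply, hs] at hn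
    linarith
  have h2 := (hconc v).2 hA hC ha hb hab
  have hi : (D (a • A + b • C)).inverse v = a • K + b • L := (hinv _ hN).inverse_apply_self _
  change a * β v ((D A).inverse v) + b * β v ((D C).inverse v) ≤
    β v ((D (a • A + b • C)).inverse v) at h2
  rw [hi] at h2
  have h3 := mul_le_mul_of_nonneg_left (h1 A hA K) ha
  have h4 := mul_le_mul_of_nonneg_left (h1 C hC L) hb
  have h5 : β v (a • K + b • L) = a * β v K + b * β v L := by simp
  change β v (a • K + b • L) ≤ _
  linarith

/-- Along a segment, the second derivative of the gap is the weighted sum of two Hessian forms minus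
the form at the combined point and direction, which is nonnegative by `hessian_combo_le`. -/
theorem convexOn_jensenGap (hUc : Convex ℝ U)
    (hinv : ∀ A ∈ U, (fderiv ℝ ψ A).IsInvertible)
    (hconc : ∀ K : E, ConcaveOn ℝ (U)
      (fun A => β K ((fderiv ℝ ψ A).inverse K)))
    {a b : ℝ} (ha : 0 ≤ a) (hb : 0 ≤ b) (hab : a + b = 1) :
    ConvexOn ℝ (U ×ˢ U) (fun x : E × E =>
      a * f x.1 + b * f x.2 - f (a • x.1 + b • x.2)) := by
  refine ⟨hUc.prod hUc, ?_⟩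
  rintro ⟨A, C⟩ ⟨hA, hC⟩ ⟨A', C'⟩ ⟨hA', hC'⟩ r s hr hs hrs
  have hline : ∀ (A A' : E) (s : ℝ), A + s • (A' - A) = (1 - s) • A + s • A' := by
    intros; module
  have hmem : ∀ {A A' : E}, A ∈ U → A' ∈ U →
      ∀ s ∈ Set.Icc (0 : ℝ) 1, A + s • (A' - A) ∈ U := by
    intro A A' hA hA' s hs
    rw [hline]
    exact hUc hA hA' (by linarith [hs.2]) hs.1 (by ring)
  have hM := hUc hA hC ha hb hab
  have hM' := hUc hA' hC' ha hb hab
  have hconv : ConvexOn ℝ (Set.Icc (0 : ℝ) 1) (fun s =>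
      a * f (A + s • (A' - A)) + b * f (C + s • (C' - C)) -
        f ((a • A + b • C) + s • ((a • A' + b • C') - (a • A + b • C)))) := by
    refine convexOn_of_hasDerivWithinAt2_nonneg (convex_Icc 0 1)
      (f' := fun s => a * β (ψ (A + s • (A' - A))) (A' - A) +
        b * β (ψ (C + s • (C' - C))) (C' - C) -
        β (ψ
          ((a • A + b • C) + s • ((a • A' + b • C') - (a • A + b • C))))
          ((a • A' + b • C') - (a • A + b • C)))
      (f'' := fun s => a * β (fderiv ℝ ψ (A + s • (A' - A)) (A' - A))
          (A' - A) +
        b * β (fderiv ℝ ψ (C + s • (C' - C)) (C' - C)) (C' - C) -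
        β (fderiv ℝ ψ
          ((a • A + b • C) + s • ((a • A' + b • C') - (a • A + b • C)))
          ((a • A' + b • C') - (a • A + b • C))) ((a • A' + b • C') - (a • A + b • C)))
      ?_ ?_ ?_ ?_
    · intro s hs
      exact ((((hasDerivAt_potential_line hU htan hdiff (hmem hA hA' s hs)).const_mul a).add
        ((hasDerivAt_potential_line hU htan hdiff (hmem hC hC' s hs)).const_mul b)).sub
        (hasDerivAt_potential_line hU htan hdiff (hmem
          hM hM' s hs))).continuousAt.continuousWithinAt
    · intro s hs
      have hs := interior_subset hs
      exact ((((hasDerivAt_potential_line hU htan hdiff (hmem hA hA' s hs)).const_mul a).add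
        ((hasDerivAt_potential_line hU htan hdiff (hmem hC hC' s hs)).const_mul b)).sub
        (hasDerivAt_potential_line hU htan hdiff (hmem hM hM' s hs))).hasDerivWithinAt
    · intro s hs
      have hs := interior_subset hs
      exact ((((hasDerivAt_gradient_line hdiff (hmem hA hA' s hs)).const_mul a).add
        ((hasDerivAt_gradient_line hdiff (hmem hC hC' s hs)).const_mul b)).sub
        (hasDerivAt_gradient_line hdiff (hmem hM hM' s hs))).hasDerivWithinAt
    · intro s hs
      have hs := interior_subset hs
      have := hessian_combo_le hU htan hdiff hUc hinv hconc (hmem hA hA' s hs) (hmem hC hC' s hs)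
        (A' - A) (C' - C) ha hb hab
      have e1 : a • (A + s • (A' - A)) + b • (C + s • (C' - C)) =
        (a • A + b • C) + s • ((a • A' + b • C') - (a • A + b • C)) := by module
      have e2 : a • (A' - A) + b • (C' - C) = (a • A' + b • C') - (a • A + b • C) := by module
      rw [e1, e2] at this
      exact sub_nonneg.2 this
  have hfin := hconv.2 (Set.left_mem_Icc.2 zero_le_one) (Set.right_mem_Icc.2 zero_le_one)
    hr hs hrs
  obtain rfl : r = 1 - s := by linarith
  simp only [smul_eq_mul, mul_zero, mul_one, zero_add, zero_smul, add_zero, one_smul,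
    add_sub_cancel] at hfin
  simp only [hline] at hfin
  have e3 : a • ((1 - s) • A + s • A') + b • ((1 - s) • C + s • C') =
    (1 - s) • (a • A + b • C) + s • (a • A' + b • C') := by module
  simp only [Prod.smul_mk, Prod.mk_add_mk, smul_eq_mul]
  rw [e3]
  exact hfin

end SecondOrder

/-- A limit of convex Jensen gaps: the Bregman divergence is jointly convex. -/
theorem convexOn_of_convexOn_jensenGap (hUc : Convex ℝ U)
    (hder : ∀ A ∈ U, HasFDerivAt f (β (ψ A)) A)
    (hgap : ∀ a b : ℝ, 0 ≤ a → 0 ≤ b → a + b = 1 → ConvexOn ℝ (U ×ˢ U) (fun x : E × E =>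
      a * f x.1 + b * f x.2 - f (a • x.1 + b • x.2))) :
    ConvexOn ℝ (U ×ˢ U) (fun x : E × E => f x.1 - f x.2 - β (ψ x.2) (x.1 - x.2)) := by
  -- As p A + (1 - p) C = C + p (A - C), the gap with weights p, 1 - p divided by p involves a
  -- difference quotient of f at C.
  have hlim : ∀ x ∈ U ×ˢ U, Tendsto (fun p : ℝ =>
      p⁻¹ * (p * f x.1 + (1 - p) * f x.2 - f (p • x.1 + (1 - p) • x.2)))
      (𝓝[>] 0) (𝓝 (f x.1 - f x.2 - β (ψ x.2) (x.1 - x.2))) := by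
    rintro ⟨A, C⟩ ⟨hA, hC⟩
    have h1 : HasDerivAt (fun s : ℝ => C + s • (A - C)) (A - C) 0 := by
      simpa using ((hasDerivAt_id (0 : ℝ)).smul_const (A - C)).const_add C
    have h2 : HasDerivAt (fun s : ℝ => f (C + s • (A - C)))
        (β (ψ C) (A - C)) 0 := by
      refine HasFDerivAt.comp_hasDerivAt (l := f) 0 ?_ h1
      simpa using hder C hC
    have h3 := h2.tendsto_slope_zero_right.const_sub (f A - f C)
    refine h3.congr' ?_
    filter_upwards [self_mem_nhdsWithin] with p hp
    have hp : p ≠ 0 := ne_of_gt hp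
    have e : C + p • (A - C) = p • A + (1 - p) • C := by module
    simp only [zero_add, zero_smul, add_zero, smul_eq_mul, e]
    field_simp
    ring
  refine ⟨hUc.prod hUc, fun x hx y hy a b ha hb hab => ?_⟩
  refine le_of_tendsto_of_tendsto
    (hlim _ ((hUc.prod hUc) hx hy ha hb hab))
    (((hlim x hx).const_mul a).add ((hlim y hy).const_mul b)) ?_
  filter_upwards [Ioo_mem_nhdsGT (zero_lt_one (α := ℝ))] with p hp
  have := (hgap p (1 - p) hp.1.le (sub_nonneg.2 hp.2.le)
    (add_sub_cancel p 1)).2 hx hy ha hb hab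
  have h1 := mul_le_mul_of_nonneg_left this (inv_nonneg.2 hp.1.le)
  simp only [smul_eq_mul] at h1 ⊢
  linarith

end Generic

/-! ### Joint convexity of the matrix Bregman divergence. -/

/-- The matrix Bregman divergence of `tr φ`. -/
noncomputable def bregman (φ ψ : ℝ → ℝ) (A C : Herm d) : ℝ :=
  trFun φ A - trFun φ C - trForm d (liftHerm d ψ C) (A - C)

theorem trFun_affine {a b : ℝ} (hφ : ∀ t ∈ Set.Ici (0 : ℝ), φ t = a * t + b) {A : Herm d}
    (hA : (A : Mat d).PosSemidef) : trFun φ A = a * ntr (A : Mat d) + b * ntr (1 : Mat d) := by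
  have h1 : stdFun φ (A : Mat d) = a • (A : Mat d) + b • (1 : Mat d) := by
    rw [stdFun_congr (g := fun t => a * t + b * 1) fun t ht => by
      rw [hφ t (spectrum_nonneg hA ht), mul_one]]
    have e := cfc_add (A : Mat d) (fun t => a * t) (fun _ : ℝ => b * 1)
      (continuousOn_spectrum _ _) (continuousOn_spectrum _ _)
    have e1 := cfc_const_mul a (fun t => t) (A : Mat d) (continuousOn_spectrum _ _)
    have e2 := cfc_const_mul b (fun _ => 1) (A : Mat d) (continuousOn_spectrum _ _)
    have i1 : cfc (fun t : ℝ => t) (A : Mat d) = A := stdFun_id A.2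
    have i2 : cfc (fun _ : ℝ => (1 : ℝ)) (A : Mat d) = 1 := stdFun_one A.2
    rw [i1] at e1
    rw [i2] at e2
    exact e.trans (congrArg₂ (· + ·) e1 e2)
  rw [trFun, h1, ntr_add, ntr_smul, ntr_smul]

/-- Affine φ is treated apart: no invertibility of Dψ is available, but the gap vanishes
identically. -/
theorem MemPhi.convexOn_jensenGap (hφ : MemPhi d φ) {a b : ℝ} (ha : 0 ≤ a) (hb : 0 ≤ b)
    (hab : a + b = 1) :
    ConvexOn ℝ (posDefSet d ×ˢ posDefSet d) (fun x : Herm d × Herm d =>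
      a * trFun φ x.1 + b * trFun φ x.2 - trFun φ (a • x.1 + b • x.2)) := by
  have hr := hφ.isRegularConvex
  rcases hφ with ⟨k, l, haff⟩ | ⟨-, -, -, h4, h5⟩
  · refine (convexOn_const 0 (convex_posDefSet.prod convex_posDefSet)).congr ?_
    rintro ⟨A, C⟩ ⟨hA, hC⟩
    have hM := convex_posDefSet hA hC ha hb hab
    simp only
    rw [trFun_affine haff (Matrix.PosDef.posSemidef hA),
      trFun_affine haff (Matrix.PosDef.posSemidef hC),
      trFun_affine haff (Matrix.PosDef.posSemidef hM)]
    have : ntr ((a • A + b • C : Herm d) : Mat d) =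
        a * ntr (A : Mat d) + b * ntr (C : Mat d) := by
      simp [ntr_add, ← ntr_smul]
    rw [this]
    linear_combination (-l * ntr (1 : Mat d)) * hab
  · exact MatrixEntropy.convexOn_jensenGap isOpen_posDefSet
      (fun A hA B hB => hr.trace_tangent_le (Matrix.PosDef.posSemidef hA) hB)
      (fun A hA => (h4 A hA).1) convex_posDefSet
      (fun A hA => (h4 A hA).2) h5 ha hb hab

/-- For `φ ∈ Φ_d` the Bregman divergence of `tr φ` is jointly convex. -/
theorem MemPhi.convexOn_bregman (hφ : MemPhi d φ) :
    ConvexOn ℝ (posDefSet d ×ˢ posDefSet d)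
      (fun x : Herm d × Herm d => bregman φ (psi φ) x.1 x.2) :=
  convexOn_of_convexOn_jensenGap (β := trForm d) convex_posDefSet
    (fun _ hA => hasFDerivAt_of_tangent_le isOpen_posDefSet
      (fun _ hA _ hB => hφ.isRegularConvex.trace_tangent_le (Matrix.PosDef.posSemidef hA) hB)
      (continuousOn_liftHerm hφ.isRegularConvex.continuousOn_psi) hA)
    fun _ _ ha hb hab => hφ.convexOn_jensenGap ha hb hab

/-! ### Two-variable subadditivity of entropy. -/

section Abstract

variable {E : Type*} [NormedAddCommGroup E] [NormedSpace ℝ E]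

/-- A continuous convex function `f` on a closed convex set `K` with gradient `ψ` (with respect to
the form `β`) on a convex subset `U`, whose Bregman divergence is jointly convex on `U × U`. The
homotheties with center `e` move `K` into `U`. -/
structure IsEntropyPotential (K U : Set E) (e : E) (β : E →L[ℝ] E →L[ℝ] ℝ) (f : E → ℝ)
    (ψ : E → E) : Prop where
  isClosed : IsClosed K
  convex : Convex ℝ K
  subset : U ⊆ K
  center_mem : e ∈ U
  homothety_mem : ∀ A ∈ K, ∀ ε ∈ Set.Ioo (0 : ℝ) 1, (1 - ε) • A + ε • e ∈ U
  continuousOn : ContinuousOn f K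
  convexOn : ConvexOn ℝ K f
  continuousOn_grad : ContinuousOn ψ U
  tangent_le : ∀ A ∈ K, ∀ C ∈ U, f C + β (ψ C) (A - C) ≤ f A
  convexOn_bregman : ConvexOn ℝ (U ×ˢ U) (fun x : E × E => f x.1 - f x.2 - β (ψ x.2) (x.1 - x.2))

variable {X Y : Type*} [MeasurableSpace X] [MeasurableSpace Y]

omit [NormedSpace ℝ E] in
theorem aestronglyMeasurable_comp_of_continuousOn [SecondCountableTopology E] {F : Type*}
    [TopologicalSpace F] [TopologicalSpace.PseudoMetrizableSpace F]
    {μ : Measure X} {L : Set E} (hL : IsClosed L) {f : E → F} (hf : ContinuousOn f L) {T : X → E}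
    (hT : AEStronglyMeasurable T μ) (hTL : ∀ᵐ x ∂μ, T x ∈ L) :
    AEStronglyMeasurable (fun x => f (T x)) μ := by
  borelize E
  have h1 := hf.aestronglyMeasurable (μ := μ.map T) hL.measurableSet
  rw [Measure.restrict_eq_self_of_ae_mem] at h1
  · exact h1.comp_aemeasurable hT.aemeasurable
  · exact (ae_map_iff hT.aemeasurable hL.measurableSet).2 hTL

theorem integral_homothety [CompleteSpace E] {μ : Measure X} [IsProbabilityMeasure μ] {T : X → E}
    (hT : Integrable T μ) (e : E) (ε : ℝ) :
    ∫ x, ((1 - ε) • T x + ε • e) ∂μ = (1 - ε) • (∫ x, T x ∂μ) + ε • e := by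
  have h1 : Integrable (fun x => (1 - ε) • T x) μ := hT.smul (1 - ε)
  rw [integral_add h1 (integrable_const _), integral_smul]
  simp

namespace IsEntropyPotential

variable {K U : Set E} {e : E} {β : E →L[ℝ] E →L[ℝ] ℝ} {f : E → ℝ} {ψ : E → E}
  (h : IsEntropyPotential K U e β f ψ) [CompleteSpace E] [SecondCountableTopology E]
  {μ : Measure X} {ν : Measure Y} [IsProbabilityMeasure μ] [IsProbabilityMeasure ν]
include h

omit [SecondCountableTopology E] in
theorem integral_mem {T : X → E} (hTK : ∀ x, T x ∈ K) (hT : Integrable T μ) :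
    ∫ x, T x ∂μ ∈ K :=
  h.convex.integral_mem h.isClosed (Eventually.of_forall hTK) hT

omit [SecondCountableTopology E] in
theorem jensen {T : X → E} (hTK : ∀ x, T x ∈ K) (hT : Integrable T μ)
    (hfT : Integrable (fun x => f (T x)) μ) : f (∫ x, T x ∂μ) ≤ ∫ x, f (T x) ∂μ :=
  h.convexOn.map_integral_le h.continuousOn h.isClosed (Eventually.of_forall hTK) hT hfT

/-- The potential of a partial expectation is integrable. -/
theorem integrable_comp_section {Z : X × Y → E} (hZK : ∀ p, Z p ∈ K)
    (hZ : Integrable Z (μ.prod ν)) (hfZ : Integrable (fun p => f (Z p)) (μ.prod ν)) :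
    Integrable (fun x => f (∫ y, Z (x, y) ∂ν)) μ := by
  have hmem : ∀ᵐ x ∂μ, ∫ y, Z (x, y) ∂ν ∈ K := by
    filter_upwards [hZ.prod_right_ae] with x hx using h.integral_mem (fun y => hZK _) hx
  -- Squeeze between the tangent at `e`, affine in the partial mean, and the conditional Jensen
  -- bound.
  refine integrable_of_le_of_le (g₁ := fun x => f e + β (ψ e) ((∫ y, Z (x, y) ∂ν) - e))
    (g₂ := fun x => ∫ y, f (Z (x, y)) ∂ν)
    (aestronglyMeasurable_comp_of_continuousOn h.isClosed h.continuousOn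
      hZ.integral_prod_left.aestronglyMeasurable hmem) ?_ ?_ ?_ hfZ.integral_prod_left
  · filter_upwards [hmem] with x hx using h.tangent_le _ hx _ h.center_mem
  · filter_upwards [hZ.prod_right_ae, hfZ.prod_right_ae] with x hx hx'
      using h.jensen (fun y => hZK _) hx hx'
  · exact (integrable_const _).add ((β (ψ e)).integrable_comp
      (hZ.integral_prod_left.sub (integrable_const e)))

/-- Two-variable subadditivity of entropy for random elements of a closed subset of `U`. -/
theorem integral_section_add_le_of_subset {L : Set E} (hL : IsClosed L) (hLc : Convex ℝ L)
    (hLU : L ⊆ U) {Z : X × Y → E} (hZL : ∀ p, Z p ∈ L)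
    (hZ : Integrable Z (μ.prod ν)) (hfZ : Integrable (fun p => f (Z p)) (μ.prod ν)) :
    ∫ x, f (∫ y, Z (x, y) ∂ν) ∂μ + ∫ y, f (∫ x, Z (x, y) ∂μ) ∂ν ≤
      f (∫ p, Z p ∂(μ.prod ν)) + ∫ p, f (Z p) ∂(μ.prod ν) := by
  have hZK : ∀ p, Z p ∈ K := fun p => h.subset (hLU (hZL p))
  have hS := h.integrable_comp_section hZK hZ hfZ
  have hC : Integrable (fun y => f (∫ x, Z (x, y) ∂μ)) ν :=
    h.integrable_comp_section (Z := fun p => Z p.swap) (fun p => hZK _) hZ.swap hfZ.swap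
  set C : Y → E := fun y => ∫ x, Z (x, y) ∂μ with hCdef
  have hCi : Integrable C ν := hZ.integral_prod_right
  have hCL : ∀ᵐ y ∂ν, C y ∈ L := by
    filter_upwards [hZ.prod_left_ae] with y hy
      using hLc.integral_mem hL (Eventually.of_forall fun x => hZL _) hy
  set m := ∫ p, Z p ∂(μ.prod ν) with hm
  have hSm : ∫ x, ∫ y, Z (x, y) ∂ν ∂μ = m := (integral_prod _ hZ).symm
  have hCm : ∫ y, C y ∂ν = m := (integral_prod_symm _ hZ).symm
  -- `B` is the divergence of Z from its partial mean C(y). Its mean over x is the entropy of Z(·,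
  -- y), while Jensen over y bounds its mean from below by the divergence of the other partial mean
  -- from m. Fubini compares the two.
  set B : X × Y → ℝ := fun p => f (Z p) - f (C p.2) - β (ψ (C p.2)) (Z p - C p.2) with hB
  have hψC : AEStronglyMeasurable (fun y => ψ (C y)) ν :=
    aestronglyMeasurable_comp_of_continuousOn hL (h.continuousOn_grad.mono hLU)
      hCi.aestronglyMeasurable hCL
  have hBm : AEStronglyMeasurable B (μ.prod ν) :=
    (hfZ.aestronglyMeasurable.sub hC.aestronglyMeasurable.comp_snd).sub
      (β.continuous₂.comp_aestronglyMeasurable₂ hψC.comp_snd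
        (hZ.aestronglyMeasurable.sub hCi.aestronglyMeasurable.comp_snd))
  have hB1 : ∀ᵐ y ∂ν, Integrable (fun x => B (x, y)) μ ∧
      ∫ x, B (x, y) ∂μ = ∫ x, f (Z (x, y)) ∂μ - f (C y) ∧
      ∫ x, ‖B (x, y)‖ ∂μ = ∫ x, B (x, y) ∂μ := by
    filter_upwards [hZ.prod_left_ae, hfZ.prod_left_ae, hCL] with y hy hfy hCy
    have i1 : Integrable (fun x => f (Z (x, y)) - f (C y)) μ := hfy.sub (integrable_const _)
    have i2 : Integrable (fun x => Z (x, y) - C y) μ := hy.sub (integrable_const _)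
    have i3 := (β (ψ (C y))).integrable_comp i2
    refine ⟨i1.sub i3, ?_, ?_⟩
    · simp only [hB]
      rw [integral_sub i1 i3, (β (ψ (C y))).integral_comp_comm i2,
        integral_sub hy (integrable_const _), integral_sub hfy (integrable_const _)]
      simp [hCdef]
    · refine integral_congr_ae (Eventually.of_forall fun x => ?_)
      have := h.tangent_le _ (hZK (x, y)) _ (hLU hCy)
      exact Real.norm_of_nonneg (by simp only [hB]; linarith)
  -- Since B ≥ 0, the iterated integral of its norm is that of the conditional entropies, which are
  -- integrable in y. Integrability of ψ(C) is not needed.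
  have hBi : Integrable B (μ.prod ν) := by
    refine (integrable_prod_iff' hBm).2 ⟨hB1.mono fun y hy => hy.1, ?_⟩
    refine (hfZ.integral_prod_right.sub hC).congr ?_
    filter_upwards [hB1] with y hy
    rw [hy.2.2, hy.2.1]; rfl
  have hB2 : ∫ p, B p ∂(μ.prod ν) = ∫ p, f (Z p) ∂(μ.prod ν) - ∫ y, f (C y) ∂ν := by
    rw [integral_prod_symm _ hBi, integral_prod_symm _ hfZ, ← integral_sub
      hfZ.integral_prod_right hC]
    exact integral_congr_ae (hB1.mono fun y hy => hy.2.1)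
  have hcont : ContinuousOn (fun x : E × E => f x.1 - f x.2 - β (ψ x.2) (x.1 - x.2))
      (L ×ˢ L) := by
    have c1 : ContinuousOn (fun x : E × E => f x.1) (L ×ˢ L) :=
      (h.continuousOn.mono (hLU.trans h.subset)).comp continuousOn_fst fun x hx => hx.1
    have c2 : ContinuousOn (fun x : E × E => f x.2) (L ×ˢ L) :=
      (h.continuousOn.mono (hLU.trans h.subset)).comp continuousOn_snd fun x hx => hx.2
    have c3 : ContinuousOn (fun x : E × E => ψ x.2) (L ×ˢ L) :=
      (h.continuousOn_grad.mono hLU).comp continuousOn_snd fun x hx => hx.2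
    exact (c1.sub c2).sub (β.continuous₂.comp_continuousOn
      (c3.prodMk (continuousOn_fst.sub continuousOn_snd)))
  have hconv := h.convexOn_bregman.subset (Set.prod_mono hLU hLU) (hLc.prod hLc)
  -- Jensen in y for the pair (Z(x, y), C(y)), where joint convexity is used. Integrating over x
  -- will then remove the linear term, because the partial means average to `m`.
  have hB3 : ∀ᵐ x ∂μ, f (∫ y, Z (x, y) ∂ν) - f m - β (ψ m) ((∫ y, Z (x, y) ∂ν) - m) ≤
      ∫ y, B (x, y) ∂ν := by
    filter_upwards [hZ.prod_right_ae, hBi.prod_right_ae] with x hx hBx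
    have := hconv.map_integral_le hcont (hL.prod hL) (μ := ν) (f := fun y => (Z (x, y), C y))
      (hCL.mono fun y hy => ⟨hZL _, hy⟩) (hx.prodMk hCi) hBx
    rw [integral_pair hx hCi, hCm] at this
    exact this
  have i1 : Integrable (fun x => f (∫ y, Z (x, y) ∂ν) - f m) μ := hS.sub (integrable_const _)
  have i2 : Integrable (fun x => (∫ y, Z (x, y) ∂ν) - m) μ :=
    hZ.integral_prod_left.sub (integrable_const _)
  have i3 := (β (ψ m)).integrable_comp i2
  have hB4 := integral_mono_ae (i1.sub i3) hBi.integral_prod_left hB3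
  rw [← integral_prod _ hBi, hB2, integral_sub' i1 i3, (β (ψ m)).integral_comp_comm i2,
    integral_sub hZ.integral_prod_left (integrable_const _), hSm,
    integral_sub hS (integrable_const _)] at hB4
  simp only [integral_const, probReal_univ, one_smul, sub_self, map_zero, sub_zero] at hB4
  linarith

-- Dominated convergence: convexity bounds the integrand above and the tangent at `e` bounds it
-- below, both uniformly in ε.
omit [CompleteSpace E] in
theorem tendsto_integral_homothety {T : X → E} (hTK : ∀ᵐ x ∂μ, T x ∈ K) (hT : Integrable T μ)
    (hfT : Integrable (fun x => f (T x)) μ) :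
    Tendsto (fun ε : ℝ => ∫ x, f ((1 - ε) • T x + ε • e) ∂μ) (𝓝[>] 0)
      (𝓝 (∫ x, f (T x) ∂μ)) := by
  have hε : ∀ᶠ ε : ℝ in 𝓝[>] 0, ε ∈ Set.Ioo (0 : ℝ) 1 := Ioo_mem_nhdsGT zero_lt_one
  refine tendsto_integral_filter_of_dominated_convergence
    (fun x => ‖f (T x)‖ + ‖f e‖ + ‖β (ψ e) (T x - e)‖) ?_ ?_ ?_ ?_
  · filter_upwards [hε] with ε hε
    refine aestronglyMeasurable_comp_of_continuousOn h.isClosed h.continuousOn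
      (((hT.aestronglyMeasurable.const_smul _).add aestronglyMeasurable_const)) ?_
    filter_upwards [hTK] with x hx using h.subset (h.homothety_mem _ hx ε hε)
  · filter_upwards [hε] with ε hε
    filter_upwards [hTK] with x hx
    have h1 := h.convexOn.2 hx (h.subset h.center_mem) (sub_nonneg.2 hε.2.le) hε.1.le
      (sub_add_cancel 1 ε)
    have h2 := h.tangent_le _ (h.subset (h.homothety_mem _ hx ε hε)) _ h.center_mem
    have e1 : (1 - ε) • T x + ε • e - e = (1 - ε) • (T x - e) := by module
    rw [e1, map_smul] at h2
    simp only [smul_eq_mul] at h1 h2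
    have h3 : 0 ≤ 1 - ε := sub_nonneg.2 hε.2.le
    have h4 : 1 - ε ≤ 1 := by linarith [hε.1]
    have h5 : |(1 - ε) * f (T x)| ≤ |f (T x)| := by
      rw [abs_mul, abs_of_nonneg h3]; exact mul_le_of_le_one_left (abs_nonneg _) h4
    have h6 : |(1 - ε) * β (ψ e) (T x - e)| ≤ |β (ψ e) (T x - e)| := by
      rw [abs_mul, abs_of_nonneg h3]; exact mul_le_of_le_one_left (abs_nonneg _) h4
    have h7 : |ε * f e| ≤ |f e| := by
      rw [abs_mul, abs_of_nonneg hε.1.le]; exact mul_le_of_le_one_left (abs_nonneg _) hε.2.le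
    simp only [Real.norm_eq_abs]
    rw [abs_le] at h5 h6 h7 ⊢
    have := abs_nonneg (f (T x))
    have := abs_nonneg (β (ψ e) (T x - e))
    have := neg_abs_le (f e)
    constructor <;> linarith
  · exact (hfT.norm.add (integrable_const _)).add
      ((β (ψ e)).integrable_comp (hT.sub (integrable_const _))).norm
  · filter_upwards [hTK] with x hx
    have h1 : ContinuousWithinAt f K (T x) := h.continuousOn _ hx
    refine Tendsto.comp h1 (tendsto_nhdsWithin_iff.2 ⟨?_, ?_⟩)
    · have : Continuous fun ε : ℝ => (1 - ε) • T x + ε • e := by fun_prop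
      simpa using (this.tendsto 0).mono_left nhdsWithin_le_nhds
    · filter_upwards [hε] with ε hε using h.subset (h.homothety_mem _ hx ε hε)

/-- Two-variable subadditivity of entropy. -/
theorem integral_section_add_le {Z : X × Y → E} (hZK : ∀ p, Z p ∈ K)
    (hZ : Integrable Z (μ.prod ν)) (hfZ : Integrable (fun p => f (Z p)) (μ.prod ν)) :
    ∫ x, f (∫ y, Z (x, y) ∂ν) ∂μ + ∫ y, f (∫ x, Z (x, y) ∂μ) ∂ν ≤
      f (∫ p, Z p ∂(μ.prod ν)) + ∫ p, f (Z p) ∂(μ.prod ν) := by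
  have hS := h.integrable_comp_section hZK hZ hfZ
  have hC : Integrable (fun y => f (∫ x, Z (x, y) ∂μ)) ν :=
    h.integrable_comp_section (Z := fun p => Z p.swap) (fun p => hZK _) hZ.swap hfZ.swap
  have hSK : ∀ᵐ x ∂μ, ∫ y, Z (x, y) ∂ν ∈ K := by
    filter_upwards [hZ.prod_right_ae] with x hx using h.integral_mem (fun y => hZK _) hx
  have hCK : ∀ᵐ y ∂ν, ∫ x, Z (x, y) ∂μ ∈ K := by
    filter_upwards [hZ.prod_left_ae] with y hy using h.integral_mem (fun x => hZK _) hy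
  have tS := h.tendsto_integral_homothety hSK hZ.integral_prod_left hS
  have tC := h.tendsto_integral_homothety hCK hZ.integral_prod_right hC
  have tZ := h.tendsto_integral_homothety (Eventually.of_forall hZK) hZ hfZ
  have tm := h.tendsto_integral_homothety (μ := μ)
    (Eventually.of_forall fun _ => h.integral_mem hZK hZ) (integrable_const _) (integrable_const _)
  simp only [integral_const, probReal_univ, one_smul] at tm
  refine le_of_tendsto_of_tendsto (tS.add tC) (tm.add tZ) ?_
  filter_upwards [Ioo_mem_nhdsGT (zero_lt_one (α := ℝ))] with ε hε
  have hε1 : 0 < 1 - ε := sub_pos.2 hε.2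
  -- The image of K under the homothety: closed, convex and inside U, so the case already proved
  -- applies to the shifted Z before ε ↓ 0.
  set L : Set E := {A | (1 - ε)⁻¹ • (A - ε • e) ∈ K} with hLdef
  have hLmem : ∀ A, A ∈ K → (1 - ε) • A + ε • e ∈ L := fun A hA => by
    rw [hLdef, Set.mem_ofPred_eq, add_sub_cancel_right, inv_smul_smul₀ hε1.ne']
    exact hA
  have hL : IsClosed L := h.isClosed.preimage (by fun_prop)
  have hLc : Convex ℝ L := by
    intro A hA B hB a b ha hb hab
    have e1 : (1 - ε)⁻¹ • (a • A + b • B - ε • e) =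
        a • (1 - ε)⁻¹ • (A - ε • e) + b • (1 - ε)⁻¹ • (B - ε • e) := by
      obtain rfl : a = 1 - b := by linarith
      module
    rw [hLdef, Set.mem_ofPred_eq, e1]
    exact h.convex hA hB ha hb hab
  have hLU : L ⊆ U := fun A hA => by
    have := h.homothety_mem _ hA ε hε
    rwa [smul_inv_smul₀ hε1.ne', sub_add_cancel] at this
  have hZε : Integrable (fun p => (1 - ε) • Z p + ε • e) (μ.prod ν) :=
    (hZ.smul _).add (integrable_const _)
  have key : Integrable (fun p => f ((1 - ε) • Z p + ε • e)) (μ.prod ν) := by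
    refine integrable_of_le_of_le
      (g₁ := fun p => f e + β (ψ e) ((1 - ε) • Z p + ε • e - e))
      (g₂ := fun p => (1 - ε) * f (Z p) + ε * f e)
      (aestronglyMeasurable_comp_of_continuousOn h.isClosed h.continuousOn
        hZε.aestronglyMeasurable (Eventually.of_forall fun p => h.subset (hLU (hLmem _ (hZK p)))))
      (Eventually.of_forall fun p =>
        h.tangent_le _ (h.subset (hLU (hLmem _ (hZK p)))) _ h.center_mem)
      (Eventually.of_forall fun p => h.convexOn.2 (hZK p) (h.subset h.center_mem) hε1.le hε.1.le
        (sub_add_cancel 1 ε)) ?_ ?_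
    · exact (integrable_const _).add ((β (ψ e)).integrable_comp (hZε.sub (integrable_const e)))
    · exact (hfZ.const_mul _).add (integrable_const _)
  have main := h.integral_section_add_le_of_subset hL hLc hLU
    (fun p => hLmem _ (hZK p)) hZε key
  have e1 : ∫ x, f (∫ y, ((1 - ε) • Z (x, y) + ε • e) ∂ν) ∂μ =
      ∫ x, f ((1 - ε) • (∫ y, Z (x, y) ∂ν) + ε • e) ∂μ := by
    refine integral_congr_ae ?_
    filter_upwards [hZ.prod_right_ae] with x hx
    rw [integral_homothety hx]
  have e2 : ∫ y, f (∫ x, ((1 - ε) • Z (x, y) + ε • e) ∂μ) ∂ν =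
      ∫ y, f ((1 - ε) • (∫ x, Z (x, y) ∂μ) + ε • e) ∂ν := by
    refine integral_congr_ae ?_
    filter_upwards [hZ.prod_left_ae] with y hy
    rw [integral_homothety hy]
  rw [e1, e2, integral_homothety hZ] at main
  exact main

end IsEntropyPotential
end Abstract

/-! ### Tensorization over n independent coordinates. -/

/-- For non-integrable `g` the Bochner integral is 0 by convention, so no integrability hypothesis
is needed. -/
theorem ofReal_integral_le_lintegral {X : Type*} [MeasurableSpace X] {μ : Measure X} (g : X → ℝ) :
    ENNReal.ofReal (∫ x, g x ∂μ) ≤ ∫⁻ x, ENNReal.ofReal (g x) ∂μ := by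
  by_cases hg : Integrable g μ
  · rw [integral_eq_lintegral_pos_part_sub_lintegral_neg_part hg]
    exact (ENNReal.ofReal_le_ofReal (sub_le_self _ ENNReal.toReal_nonneg)).trans
      ENNReal.ofReal_toReal_le
  · simp [integral_undef hg]

/-- Induction on n, splitting off coordinate 0: by subadditivity the entropy is at most the mean
entropy in that coordinate plus the mean entropy in the others. The slack `η` leaves room for a
truncation error in each one-variable bound. -/
theorem IsEntropyPotential.ofReal_entropy_pi_le {E : Type*} [NormedAddCommGroup E]
    [NormedSpace ℝ E] [CompleteSpace E] [SecondCountableTopology E] {K U : Set E} {e : E}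
    {β : E →L[ℝ] E →L[ℝ] ℝ} {f : E → ℝ} {ψ : E → E} (h : IsEntropyPotential K U e β f ψ)
    {S : Type*} [MeasurableSpace S] {D : E × E → ℝ≥0∞} (hD : Continuous D) {η : ℝ≥0∞}
    (hone : ∀ (ν : Measure S) [IsProbabilityMeasure ν] (T : S → E), StronglyMeasurable T →
      (∀ s, T s ∈ K) → Integrable T ν → Integrable (fun s => f (T s)) ν →
      ENNReal.ofReal (∫ s, f (T s) ∂ν - f (∫ s, T s ∂ν)) ≤
        ∫⁻ s, ∫⁻ s', D (T s, T s') ∂ν ∂ν + η)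
    (n : ℕ) (μ : Fin n → Measure S) [∀ i, IsProbabilityMeasure (μ i)] (F : (Fin n → S) → E)
    (hF : StronglyMeasurable F) (hFK : ∀ x, F x ∈ K) (hFi : Integrable F (Measure.pi μ))
    (hfF : Integrable (fun x => f (F x)) (Measure.pi μ)) :
    ENNReal.ofReal (∫ x, f (F x) ∂(Measure.pi μ) - f (∫ x, F x ∂(Measure.pi μ))) ≤
      ∑ i, ∫⁻ x, ∫⁻ s, D (F x, F (Function.update x i s)) ∂(μ i) ∂(Measure.pi μ) + n * η := by
  induction n with
  | zero =>
    have : ∀ x, F x = F default := fun x => congrArg F (Subsingleton.elim _ _)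
    simp [this]
  | succ n ih =>
    set μ' : Fin n → Measure S := fun j => μ (Fin.succAbove 0 j) with hμ'
    set Q := Measure.pi μ' with hQ
    have hmp := (measurePreserving_piFinSuccAbove μ 0).symm
    set c := (MeasurableEquiv.piFinSuccAbove (fun _ : Fin (n + 1) => S) 0).symm with hc
    have hcons : ∀ s x, c (s, x) = Fin.cons s x := fun s x => by
      rw [hc, MeasurableEquiv.piFinSuccAbove_symm_apply]
      exact Fin.insertNth_zero' s x
    set Z : S × (Fin n → S) → E := fun p => F (c p) with hZdef
    have hZm : StronglyMeasurable Z := hF.comp_measurable c.measurable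
    have hZK : ∀ p, Z p ∈ K := fun p => hFK _
    have hZ : Integrable Z ((μ 0).prod Q) := hmp.integrable_comp_of_integrable hFi
    have hfZ : Integrable (fun p => f (Z p)) ((μ 0).prod Q) :=
      hmp.integrable_comp_of_integrable hfF
    have hDm : ∀ i, Measurable fun p : (Fin (n + 1) → S) × S =>
        D (F p.1, F (Function.update p.1 i p.2)) := fun i =>
      (hD.comp_stronglyMeasurable ((hF.comp_measurable measurable_fst).prodMk
        (hF.comp_measurable measurable_update'))).measurable
    have hDm' : ∀ i, Measurable fun x : Fin (n + 1) → S =>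
        ∫⁻ s, D (F x, F (Function.update x i s)) ∂(μ i) := fun i =>
      (hDm i).lintegral_prod_right'
    have hDc : ∀ i, Measurable fun p : S × (Fin n → S) =>
        ∫⁻ s, D (F (c p), F (Function.update (c p) i s)) ∂(μ i) := fun i =>
      (hDm' i).comp c.measurable
    have hsplit := h.integral_section_add_le hZK hZ hfZ
    have hS := h.integrable_comp_section hZK hZ hfZ
    have hC : Integrable (fun x => f (∫ s, Z (s, x) ∂(μ 0))) Q :=
      h.integrable_comp_section (Z := fun p => Z p.swap) (fun p => hZK _) hZ.swap hfZ.swap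
    have e1 : ∫ x, f (F x) ∂(Measure.pi μ) = ∫ p, f (Z p) ∂((μ 0).prod Q) :=
      (hmp.integral_comp c.measurableEmbedding (fun x => f (F x))).symm
    have e2 : ∫ x, F x ∂(Measure.pi μ) = ∫ p, Z p ∂((μ 0).prod Q) :=
      (hmp.integral_comp c.measurableEmbedding F).symm
    have e3 : ∀ g : (Fin (n + 1) → S) → ℝ≥0∞, Measurable g →
        ∫⁻ x, g x ∂(Measure.pi μ) = ∫⁻ p, g (c p) ∂((μ 0).prod Q) := fun g hg =>
      (hmp.lintegral_comp hg).symm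
    have b1 : ENNReal.ofReal
        (∫ x, (∫ s, f (Z (s, x)) ∂(μ 0) - f (∫ s, Z (s, x) ∂(μ 0))) ∂Q) ≤
        ∫⁻ x, ∫⁻ s, D (F x, F (Function.update x 0 s)) ∂(μ 0) ∂(Measure.pi μ) + η := by
      rw [e3 _ (hDm' 0), lintegral_prod_symm _ (hDc 0).aemeasurable]
      calc _ ≤ ∫⁻ x, ENNReal.ofReal
            (∫ s, f (Z (s, x)) ∂(μ 0) - f (∫ s, Z (s, x) ∂(μ 0))) ∂Q :=
            ofReal_integral_le_lintegral _
        _ ≤ ∫⁻ x, (∫⁻ s, ∫⁻ s', D (F (c (s, x)),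
              F (Function.update (c (s, x)) 0 s')) ∂(μ 0) ∂(μ 0) + η) ∂Q := by
            refine lintegral_mono_ae ?_
            filter_upwards [hZ.prod_left_ae, hfZ.prod_left_ae] with x hx hfx
            have := hone (μ 0) (fun s => Z (s, x)) (hZm.comp_measurable measurable_prodMk_right)
              (fun s => hZK _) hx hfx
            simpa only [hZdef, hcons, Fin.update_cons_zero] using this
        _ = _ := by
            rw [lintegral_add_right _ measurable_const]
            simp
    have b2 : ENNReal.ofReal
        (∫ s, (∫ x, f (Z (s, x)) ∂Q - f (∫ x, Z (s, x) ∂Q)) ∂(μ 0)) ≤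
        ∑ j : Fin n, ∫⁻ x, ∫⁻ s, D (F x, F (Function.update x j.succ s)) ∂(μ j.succ)
          ∂(Measure.pi μ) + n * η := by
      have e4 : ∀ j : Fin n, ∫⁻ x, ∫⁻ s, D (F x, F (Function.update x j.succ s)) ∂(μ j.succ)
          ∂(Measure.pi μ) = ∫⁻ s, ∫⁻ x, ∫⁻ s', D (F (c (s, x)),
            F (Function.update (c (s, x)) j.succ s')) ∂(μ j.succ) ∂Q ∂(μ 0) := fun j => by
        rw [e3 _ (hDm' _), lintegral_prod _ (hDc _).aemeasurable]
      simp only [e4]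
      rw [← lintegral_finsetSum _ fun j _ =>
        (hDc j.succ).lintegral_prod_right']
      calc _ ≤ ∫⁻ s, ENNReal.ofReal
            (∫ x, f (Z (s, x)) ∂Q - f (∫ x, Z (s, x) ∂Q)) ∂(μ 0) :=
            ofReal_integral_le_lintegral _
        _ ≤ ∫⁻ s, (∑ j : Fin n, ∫⁻ x, ∫⁻ s', D (F (c (s, x)),
            F (Function.update (c (s, x)) j.succ s')) ∂(μ j.succ) ∂Q + n * η) ∂(μ 0) := by
            refine lintegral_mono_ae ?_
            filter_upwards [hZ.prod_right_ae, hfZ.prod_right_ae] with s hs hfs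
            have := ih μ' (fun x => Z (s, x)) (hZm.comp_measurable measurable_prodMk_left)
              (fun x => hZK _) hs hfs
            simpa only [hZdef, hcons, Fin.cons_update, hQ, hμ', Fin.zero_succAbove] using this
        _ = _ := by
            rw [lintegral_add_right _ measurable_const]
            simp
    have hfin : ∫ x, f (F x) ∂(Measure.pi μ) - f (∫ x, F x ∂(Measure.pi μ)) ≤
        ∫ x, (∫ s, f (Z (s, x)) ∂(μ 0) - f (∫ s, Z (s, x) ∂(μ 0))) ∂Q +
        ∫ s, (∫ x, f (Z (s, x)) ∂Q - f (∫ x, Z (s, x) ∂Q)) ∂(μ 0) := by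
      rw [e1, e2, integral_sub hfZ.integral_prod_right hC, integral_sub hfZ.integral_prod_left hS,
        ← integral_prod _ hfZ, ← integral_prod_symm _ hfZ]
      linarith
    calc _ ≤ _ := (ENNReal.ofReal_le_ofReal hfin).trans ENNReal.ofReal_add_le
      _ ≤ _ := add_le_add b1 b2
      _ = _ := by
        rw [Fin.sum_univ_succ]
        push_cast
        ring

/-! ### Truncation of φ near 0. -/

variable {δ : ℝ}

/-- The derivative `psi φ` frozen below `δ`. -/
noncomputable def truncPsi (φ : ℝ → ℝ) (δ t : ℝ) : ℝ := psi φ (max t δ)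

/-- The function `φ` replaced below `δ` by its tangent line at `δ`. -/
noncomputable def truncPhi (φ : ℝ → ℝ) (δ t : ℝ) : ℝ := φ (max t δ) + psi φ δ * (min t δ - δ)

/-- A bound for the uniform distance of `truncPhi φ δ` and `φ` on `[0, ∞)`. -/
noncomputable def truncError (φ : ℝ → ℝ) (δ : ℝ) : ℝ := φ 0 - φ δ + (φ (2 * δ) - φ δ)

namespace IsRegularConvex

variable (h : IsRegularConvex φ)
include h

theorem continuous_truncPsi (hδ : 0 < δ) : Continuous (truncPsi φ δ) :=
  h.continuousOn_psi.comp_continuous (by fun_prop) fun t => lt_of_lt_of_le hδ (le_max_right t δ)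

theorem continuous_truncPhi (hδ : 0 < δ) : Continuous (truncPhi φ δ) := by
  have : Continuous fun t => φ (max t δ) :=
    h.continuousOn.comp_continuous (by fun_prop) fun t => hδ.le.trans (le_max_right t δ)
  exact this.add (by fun_prop)

/-- Writing t = max t δ + min t δ - δ isolates the tangent inequality of φ at points ≥ δ. The
remainder is nonnegative: either max b δ = δ, or min b δ = δ ≥ min a δ. -/
theorem truncPhi_tangent_le (hδ : 0 < δ) (a b : ℝ) :
    truncPhi φ δ b + truncPsi φ δ b * (a - b) ≤ truncPhi φ δ a := by
  have h1 := h.tangent_le (hδ.le.trans (le_max_right a δ)) (lt_of_lt_of_le hδ (le_max_right b δ))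
  have ea : a = max a δ + min a δ - δ := by rw [max_add_min]; ring
  have eb : b = max b δ + min b δ - δ := by rw [max_add_min]; ring
  have h2 : 0 ≤ (psi φ δ - psi φ (max b δ)) * (min a δ - min b δ) := by
    rcases le_total δ b with hb | hb
    · refine mul_nonneg_of_nonpos_of_nonpos ?_ ?_
      · exact sub_nonpos.2 (h.monotoneOn_psi hδ (lt_of_lt_of_le hδ (le_max_right b δ))
          (le_max_right b δ))
      · rw [min_eq_right hb]
        exact sub_nonpos.2 (min_le_right a δ)
    · rw [max_eq_right hb, sub_self, zero_mul]
  have h3 : psi φ (max b δ) * (a - b) = psi φ (max b δ) * (max a δ - max b δ) +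
      psi φ (max b δ) * (min a δ - min b δ) := by
    rw [← mul_add]; congr 1; linarith
  unfold truncPhi truncPsi
  rw [h3]
  linarith

theorem truncError_nonneg (hδ : 0 < δ) : 0 ≤ truncError φ δ := by
  have h1 := h.tangent_le le_rfl hδ
  have h2 := h.tangent_le (by linarith : (0 : ℝ) ≤ 2 * δ) hδ
  unfold truncError
  linarith

/-- Below δ, φ lies between its tangent at δ and its chord over [0, δ]; their distance is at most
φ(0) - φ(δ) + δψ(δ). The tangent inequality at 2δ gives δψ(δ) ≤ φ(2δ) - φ(δ), leaving a bound in
values of φ alone, which tends to 0 by continuity. -/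
theorem abs_truncPhi_sub_le (hδ : 0 < δ) {t : ℝ} (ht : 0 ≤ t) :
    |truncPhi φ δ t - φ t| ≤ truncError φ δ := by
  have h0 := h.truncError_nonneg hδ
  rcases le_total δ t with htδ | htδ
  · simpa [truncPhi, max_eq_left htδ, min_eq_right htδ] using h0
  · have h1 := h.tangent_le ht hδ
    have h2 := h.tangent_le (by linarith : (0 : ℝ) ≤ 2 * δ) hδ
    have h3 := h.convexOn.2 (Set.mem_Ici.2 le_rfl) (Set.mem_Ici.2 hδ.le)
      (sub_nonneg.2 ((div_le_one hδ).2 htδ)) (div_nonneg ht hδ.le) (sub_add_cancel 1 (t / δ))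
    have e : (1 - t / δ) • (0 : ℝ) + (t / δ) • δ = t := by
      simp [div_mul_cancel₀ _ hδ.ne']
    rw [e] at h3
    simp only [smul_eq_mul] at h3
    have h4 : 0 ≤ t / δ := div_nonneg ht hδ.le
    have h5 : 0 ≤ φ 0 - φ δ + psi φ δ * δ := by linarith [h.tangent_le le_rfl hδ]
    have h6 : t = t / δ * δ := (div_mul_cancel₀ _ hδ.ne').symm
    have h7 := mul_nonneg h4 h5
    have h8 : psi φ δ * t = t / δ * (psi φ δ * δ) := by rw [mul_left_comm, ← h6]
    simp only [truncPhi, max_eq_right htδ, min_eq_left htδ, truncError]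
    rw [abs_le]
    constructor
    · linarith
    · linarith

theorem tendsto_truncError : Tendsto (truncError φ) (𝓝[>] 0) (𝓝 0) := by
  have h0 : Tendsto φ (𝓝[≥] 0) (𝓝 (φ 0)) := h.continuousOn 0 (Set.mem_Ici.2 le_rfl)
  have h1 : Tendsto φ (𝓝[>] 0) (𝓝 (φ 0)) :=
    h0.mono_left (nhdsWithin_mono 0 Set.Ioi_subset_Ici_self)
  have h2 : Tendsto (fun δ : ℝ => φ (2 * δ)) (𝓝[>] 0) (𝓝 (φ 0)) := by
    refine h1.comp (tendsto_nhdsWithin_iff.2 ⟨?_, ?_⟩)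
    · have : Continuous fun δ : ℝ => 2 * δ := by fun_prop
      simpa using (this.tendsto 0).mono_left nhdsWithin_le_nhds
    · filter_upwards [self_mem_nhdsWithin] with δ hδ
      exact mul_pos two_pos (Set.mem_Ioi.1 hδ)
  have h3 := (h1.const_sub (φ 0)).add (h2.sub h1)
  rw [sub_self, add_zero] at h3
  exact h3

end IsRegularConvex

theorem abs_trFun_sub_le {f g : ℝ → ℝ} {c : ℝ} {A : Herm d}
    (hfg : ∀ t ∈ spectrum ℝ (A : Mat d), |f t - g t| ≤ c) (hc : 0 ≤ c) :
    |trFun f A - trFun g A| ≤ c := by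
  obtain ⟨a, b, w, hw, ha, hb, hsum⟩ := exists_double_spectral_sum A.2 A.2
  have e2 : ∀ f : ℝ → ℝ, trFun f A = ∑ i, ∑ j, w i j * f (a i) := fun f => by
    simpa [stdFun_one A.2, trFun] using hsum f (fun _ => 1)
  -- The total weight is tr 1, equal to 1 unless d = 0, where division by zero makes it 0.
  have e1 : ∑ i, ∑ j, w i j ≤ 1 := by
    have := hsum (fun _ => 1) (fun _ => 1)
    simp only [stdFun_one A.2, mul_one] at this
    rw [← this, ntr, Matrix.trace_one]
    simpa using div_self_le_one (d : ℝ)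
  rw [e2, e2, ← Finset.sum_sub_distrib]
  calc |∑ i, (∑ j, w i j * f (a i) - ∑ j, w i j * g (a i))|
      = |∑ i, ∑ j, w i j * (f (a i) - g (a i))| := by
        congr 1
        refine Finset.sum_congr rfl fun i _ => ?_
        rw [← Finset.sum_sub_distrib]
        exact Finset.sum_congr rfl fun j _ => by ring
    _ ≤ ∑ i, ∑ j, |w i j * (f (a i) - g (a i))| :=
        (Finset.abs_sum_le_sum_abs _ _).trans
          (Finset.sum_le_sum fun i _ => Finset.abs_sum_le_sum_abs _ _)
    _ ≤ ∑ i, ∑ j, w i j * c := by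
        refine Finset.sum_le_sum fun i _ => Finset.sum_le_sum fun j _ => ?_
        rw [abs_mul, abs_of_nonneg (hw i j)]
        exact mul_le_mul_of_nonneg_left (hfg _ (ha i)) (hw i j)
    _ = (∑ i, ∑ j, w i j) * c := by simp only [Finset.sum_mul]
    _ ≤ c := mul_le_of_le_one_left hc e1

theorem continuous_trFun {f : ℝ → ℝ} (hf : Continuous f) :
    Continuous (trFun f : Herm d → ℝ) :=
  continuous_ntr.comp (continuous_stdFun hf)

/-! ### The positive-semidefinite cone and tr φ as an entropy potential. -/

/-- The cone `ℍ^d₊` of positive-semidefinite matrices. -/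
def psdSet (d : ℕ) : Set (Herm d) := {A | (A : Mat d).PosSemidef}

theorem convex_psdSet : Convex ℝ (psdSet d) := fun A hA B hB a b ha hb _ => by
  have h1 : ((a • A : Herm d) : Mat d).PosSemidef := by
    simpa using Matrix.PosSemidef.smul hA ha
  have h2 : ((b • B : Herm d) : Mat d).PosSemidef := by
    simpa using Matrix.PosSemidef.smul hB hb
  exact h1.add h2

theorem isClosed_psdSet : IsClosed (psdSet d) := by
  have : psdSet d = ⋂ x : Fin d → ℂ,
      {A : Herm d | 0 ≤ star x ⬝ᵥ (A : Mat d).mulVec x} := by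
    ext A
    simp only [psdSet, Set.mem_ofPred_eq, Set.mem_iInter,
      Matrix.posSemidef_iff_dotProduct_mulVec, isHermitian_coe A, true_and]
  rw [this]
  refine isClosed_iInter fun x => isClosed_le continuous_const ?_
  exact continuous_const.dotProduct
    (Continuous.matrix_mulVec (A := fun A : Herm d => (A : Mat d)) continuous_subtype_val
      continuous_const)

theorem posDefSet_subset : posDefSet d ⊆ psdSet d := fun _ hA => Matrix.PosDef.posSemidef hA

namespace IsRegularConvex

variable (h : IsRegularConvex φ)
include h

theorem abs_trFun_truncPhi_sub_le (hδ : 0 < δ) {A : Herm d} (hA : A ∈ psdSet d) :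
    |trFun (truncPhi φ δ) A - trFun φ A| ≤ truncError φ δ :=
  abs_trFun_sub_le (fun _ ht => h.abs_truncPhi_sub_le hδ (spectrum_nonneg hA ht))
    (h.truncError_nonneg hδ)

theorem bregman_trunc_nonneg (hδ : 0 < δ) (A B : Herm d) :
    0 ≤ bregman (truncPhi φ δ) (truncPsi φ δ) A B := by
  have := klein A.2 B.2 (Set.subset_univ _) (Set.subset_univ _)
    (fun a _ b _ => h.truncPhi_tangent_le hδ a b)
  have : trFun (truncPhi φ δ) B + trForm d (liftHerm d (truncPsi φ δ) B) (A - B) ≤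
    trFun (truncPhi φ δ) A := this
  unfold bregman
  linarith

theorem continuousOn_trFun : ContinuousOn (trFun φ) (psdSet d) := by
  have h1 : Continuous fun t => φ (max t 0) :=
    h.continuousOn.comp_continuous (by fun_prop) fun t => le_max_right t 0
  refine (continuous_trFun h1).continuousOn.congr fun A hA => ?_
  rw [trFun, trFun]
  congr 1
  exact stdFun_congr fun t ht => by rw [max_eq_left (spectrum_nonneg hA ht)]

/-- On the boundary of the cone φ has no usable tangent. The truncation has one at every Hermitian
matrix: average the two inequalities based at the convex combination, so that the linear terms
cancel, and let δ ↓ 0. -/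
theorem convexOn_trFun : ConvexOn ℝ (psdSet d) (trFun φ) := by
  refine ⟨convex_psdSet, fun A hA B hB a b ha hb hab => ?_⟩
  have hN := convex_psdSet hA hB ha hb hab
  have hlim : Tendsto (fun δ => a • trFun φ A + b • trFun φ B + 2 * truncError φ δ) (𝓝[>] 0)
      (𝓝 (a • trFun φ A + b • trFun φ B)) := by
    simpa using (h.tendsto_truncError.const_mul 2).const_add (a • trFun φ A + b • trFun φ B)
  refine ge_of_tendsto hlim ?_
  filter_upwards [self_mem_nhdsWithin] with δ hδ
  have hδ : 0 < δ := hδ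
  have h1 := h.bregman_trunc_nonneg hδ A (a • A + b • B)
  have h2 := h.bregman_trunc_nonneg hδ B (a • A + b • B)
  have hA1 := abs_le.1 (h.abs_trFun_truncPhi_sub_le hδ hA)
  have hB1 := abs_le.1 (h.abs_trFun_truncPhi_sub_le hδ hB)
  have hN1 := abs_le.1 (h.abs_trFun_truncPhi_sub_le hδ hN)
  unfold bregman at h1 h2
  rw [map_sub] at h1 h2
  set G := trForm d (liftHerm d (truncPsi φ δ) (a • A + b • B)) with hG
  have e : G (a • A + b • B) = a * G A + b * G B := by simp
  have h3 := mul_le_mul_of_nonneg_left hA1.2 ha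
  have h4 := mul_le_mul_of_nonneg_left hB1.2 hb
  have h5 := mul_nonneg ha h1
  have h6 := mul_nonneg hb h2
  obtain rfl : b = 1 - a := by linarith
  simp only [smul_eq_mul]
  nlinarith

end IsRegularConvex

theorem MemPhi.isEntropyPotential (hφ : MemPhi d φ) :
    IsEntropyPotential (psdSet d) (posDefSet d) (⟨1, IsSelfAdjoint.one _⟩ : Herm d) (trForm d)
      (trFun φ) (liftHerm d (psi φ)) where
  isClosed := isClosed_psdSet
  convex := convex_psdSet
  subset := posDefSet_subset
  center_mem := Matrix.PosDef.one
  homothety_mem A hA ε hε := by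
    have h1 : (((1 - ε) • A : Herm d) : Mat d).PosSemidef := by
      simpa using Matrix.PosSemidef.smul hA (sub_nonneg.2 hε.2.le)
    have h2 : ((ε • (⟨1, IsSelfAdjoint.one _⟩ : Herm d) : Herm d) : Mat d).PosDef := by
      simpa using Matrix.PosDef.smul (Matrix.PosDef.one (n := Fin d) (R := ℂ)) hε.1
    exact Matrix.PosDef.posSemidef_add h1 h2
  continuousOn := hφ.isRegularConvex.continuousOn_trFun
  convexOn := hφ.isRegularConvex.convexOn_trFun
  continuousOn_grad := continuousOn_liftHerm hφ.isRegularConvex.continuousOn_psi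
  tangent_le _ hA _ hC := hφ.isRegularConvex.trace_tangent_le hA hC
  convexOn_bregman := hφ.convexOn_bregman

/-! ### The truncated Dirichlet form and the one-variable bound. -/

/-- The truncated Dirichlet form, a continuous function of a pair of Hermitian matrices. -/
noncomputable def truncDirichlet (φ : ℝ → ℝ) (δ : ℝ) (p : Herm d × Herm d) : ℝ :=
  ntr (((p.1 : Mat d) - (p.2 : Mat d)) *
    (stdFun (truncPsi φ δ) (p.1 : Mat d) - stdFun (truncPsi φ δ) (p.2 : Mat d)))

/-- In the symmetrized divergence the values of the potential cancel and only the gradient terms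
remain. -/
theorem truncDirichlet_eq (A B : Herm d) : truncDirichlet φ δ (A, B) =
    bregman (truncPhi φ δ) (truncPsi φ δ) A B + bregman (truncPhi φ δ) (truncPsi φ δ) B A := by
  have e : truncDirichlet φ δ (A, B) = trForm d (A - B)
      (liftHerm d (truncPsi φ δ) A - liftHerm d (truncPsi φ δ) B) := rfl
  rw [e, trForm_apply, trInner_comm, ← trForm_apply, bregman, bregman, ← neg_sub A B, map_neg,
    map_sub (trForm d), sub_apply]
  ring

namespace IsRegularConvex

variable (h : IsRegularConvex φ)
include h

theorem continuous_truncDirichlet (hδ : 0 < δ) :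
    Continuous (truncDirichlet φ δ : Herm d × Herm d → ℝ) := by
  have h1 := continuous_stdFun (d := d) (h.continuous_truncPsi hδ)
  refine continuous_ntr.comp (Continuous.mul ?_ ?_)
  · exact (continuous_subtype_val.comp continuous_fst).sub
      (continuous_subtype_val.comp continuous_snd)
  · exact (h1.comp continuous_fst).sub (h1.comp continuous_snd)

theorem continuous_bregman_trunc (hδ : 0 < δ) :
    Continuous fun p : Herm d × Herm d => bregman (truncPhi φ δ) (truncPsi φ δ) p.1 p.2 := by
  have h1 := continuous_stdFun (d := d) (h.continuous_truncPsi hδ)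
  have h2 := continuous_trFun (d := d) (h.continuous_truncPhi hδ)
  refine ((h2.comp continuous_fst).sub (h2.comp continuous_snd)).sub ?_
  refine continuous_ntr.comp (Continuous.mul (h1.comp continuous_snd) ?_)
  exact continuous_subtype_val.comp (continuous_fst.sub continuous_snd)

/-- The entropy bound via exchangeability for a single variable. -/
theorem ofReal_entropy_le (hδ : 0 < δ) {S : Type*} [MeasurableSpace S] (ν : Measure S)
    [IsProbabilityMeasure ν] (T : S → Herm d) (hTm : StronglyMeasurable T)
    (hTK : ∀ s, T s ∈ psdSet d) (hT : Integrable T ν)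
    (hfT : Integrable (fun s => trFun φ (T s)) ν) :
    ENNReal.ofReal (∫ s, trFun φ (T s) ∂ν - trFun φ (∫ s, T s ∂ν)) ≤
      ∫⁻ s, ∫⁻ s', ENNReal.ofReal (truncDirichlet φ δ (T s, T s') / 2) ∂ν ∂ν +
        ENNReal.ofReal (2 * truncError φ δ) := by
  set Br := bregman (d := d) (truncPhi φ δ) (truncPsi φ δ) with hBr
  set m := ∫ s, T s ∂ν with hm
  have hmK : m ∈ psdSet d :=
    convex_psdSet.integral_mem isClosed_psdSet (Eventually.of_forall hTK) hT
  have hcl : ∀ s, |trFun (truncPhi φ δ) (T s) - trFun φ (T s)| ≤ truncError φ δ :=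
    fun s => h.abs_trFun_truncPhi_sub_le hδ (hTK s)
  have hgm : AEStronglyMeasurable (fun s => trFun (truncPhi φ δ) (T s)) ν :=
    ((continuous_trFun (h.continuous_truncPhi hδ)).comp_stronglyMeasurable
      hTm).aestronglyMeasurable
  have hdiff : Integrable (fun s => trFun (truncPhi φ δ) (T s) - trFun φ (T s)) ν :=
    (integrable_const (truncError φ δ)).mono' (hgm.sub hfT.aestronglyMeasurable)
      (Eventually.of_forall hcl)
  have hgT : Integrable (fun s => trFun (truncPhi φ δ) (T s)) ν := by
    exact (hdiff.add hfT).congr (Eventually.of_forall fun s => sub_add_cancel _ _)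
  set H := ∫ s, trFun (truncPhi φ δ) (T s) ∂ν - trFun (truncPhi φ δ) m with hH
  have hHle : ∫ s, trFun φ (T s) ∂ν - trFun φ m ≤ H + 2 * truncError φ δ := by
    have h1 : ∫ s, trFun φ (T s) ∂ν ≤
        ∫ s, (trFun (truncPhi φ δ) (T s) + truncError φ δ) ∂ν :=
      integral_mono hfT (hgT.add (integrable_const _)) fun s => by
        have := (abs_le.1 (hcl s)).1
        simp only
        linarith
    rw [integral_add hgT (integrable_const _)] at h1
    simp only [integral_const, probReal_univ, one_smul] at h1
    have h2 := (abs_le.1 (h.abs_trFun_truncPhi_sub_le hδ hmK)).2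
    linarith
  -- The mean divergence from `B` is `H + Br m B`, hence at least `H`.
  have hinner : ∀ B : Herm d, ENNReal.ofReal (H / 2) ≤
      ∫⁻ s, ENNReal.ofReal (Br (T s) B / 2) ∂ν := fun B => by
    refine le_trans (ENNReal.ofReal_le_ofReal ?_) (ofReal_integral_le_lintegral _)
    set G := trForm d (liftHerm d (truncPsi φ δ) B) with hG
    have i1 : Integrable (fun s => trFun (truncPhi φ δ) (T s) - trFun (truncPhi φ δ) B) ν :=
      hgT.sub (integrable_const _)
    have i2 : Integrable (fun s => T s - B) ν := hT.sub (integrable_const _)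
    have i3 : Integrable (fun s => G (T s - B)) ν := G.integrable_comp i2
    have e : ∫ s, Br (T s) B ∂ν = H + Br m B := by
      have e1 : ∫ s, Br (T s) B ∂ν =
          ∫ s, (trFun (truncPhi φ δ) (T s) - trFun (truncPhi φ δ) B - G (T s - B)) ∂ν := rfl
      rw [e1, integral_sub i1 i3, integral_sub hgT (integrable_const _),
        G.integral_comp_comm i2, integral_sub hT (integrable_const _)]
      simp only [integral_const, probReal_univ, one_smul]
      rw [hBr, bregman, hH]
      ring
    rw [integral_div, e]
    have := h.bregman_trunc_nonneg hδ m B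
    rw [← hBr] at this
    linarith
  have hmeas : Measurable fun p : S × S => ENNReal.ofReal (Br (T p.1) (T p.2) / 2) :=
    ((ENNReal.continuous_ofReal.comp ((h.continuous_bregman_trunc hδ).div_const
      2)).comp_stronglyMeasurable ((hTm.comp_measurable measurable_fst).prodMk
        (hTm.comp_measurable measurable_snd))).measurable
  -- Exchangeability: swapping the two integrals identifies the two halves of the symmetrized
  -- divergence.
  have hD : ∫⁻ s, ∫⁻ s', ENNReal.ofReal (truncDirichlet φ δ (T s, T s') / 2) ∂ν ∂ν =
      ∫⁻ s, ∫⁻ s', ENNReal.ofReal (Br (T s') (T s) / 2) ∂ν ∂ν +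
        ∫⁻ s, ∫⁻ s', ENNReal.ofReal (Br (T s') (T s) / 2) ∂ν ∂ν := by
    have e1 : ∀ s s', ENNReal.ofReal (truncDirichlet φ δ (T s, T s') / 2) =
        ENNReal.ofReal (Br (T s) (T s') / 2) + ENNReal.ofReal (Br (T s') (T s) / 2) := by
      intro s s'
      rw [truncDirichlet_eq, add_div, ENNReal.ofReal_add]
      · exact div_nonneg (h.bregman_trunc_nonneg hδ _ _) zero_le_two
      · exact div_nonneg (h.bregman_trunc_nonneg hδ _ _) zero_le_two
    simp only [e1]
    have e2 : ∀ s, ∫⁻ s', (ENNReal.ofReal (Br (T s) (T s') / 2) +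
        ENNReal.ofReal (Br (T s') (T s) / 2)) ∂ν =
        ∫⁻ s', ENNReal.ofReal (Br (T s) (T s') / 2) ∂ν +
          ∫⁻ s', ENNReal.ofReal (Br (T s') (T s) / 2) ∂ν := fun s =>
      lintegral_add_left (hmeas.comp measurable_prodMk_left) _
    simp only [e2]
    rw [lintegral_add_left hmeas.lintegral_prod_right', lintegral_lintegral_swap hmeas.aemeasurable]
  have hconst : ENNReal.ofReal (H / 2) ≤
      ∫⁻ s, ∫⁻ s', ENNReal.ofReal (Br (T s') (T s) / 2) ∂ν ∂ν := by
    calc ENNReal.ofReal (H / 2) = ∫⁻ _s, ENNReal.ofReal (H / 2) ∂ν := by simp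
      _ ≤ _ := lintegral_mono fun s => hinner (T s)
  calc ENNReal.ofReal (∫ s, trFun φ (T s) ∂ν - trFun φ m)
      ≤ ENNReal.ofReal ((H / 2 + H / 2) + 2 * truncError φ δ) :=
        ENNReal.ofReal_le_ofReal (by linarith)
    _ ≤ ENNReal.ofReal (H / 2) + ENNReal.ofReal (H / 2) + ENNReal.ofReal (2 * truncError φ δ) :=
        ENNReal.ofReal_add_le.trans (add_le_add_left ENNReal.ofReal_add_le _)
    _ ≤ _ := by
        rw [hD]
        gcongr

end IsRegularConvex

/-! ### Comparison of the truncated and true Dirichlet forms. -/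

/-- Freezing a monotone ψ below δ can only shrink its increments. The set `J` allows both [0, ∞) and
(0, ∞), the two alternatives in (a). -/
theorem truncDirichlet_le_dirichlet {J : Set ℝ} (hJ : MonotoneOn (psi φ) J) (hδ : δ ∈ J)
    {A B : Herm d} (hA : spectrum ℝ (A : Mat d) ⊆ J) (hB : spectrum ℝ (B : Mat d) ⊆ J) :
    truncDirichlet φ δ (A, B) ≤ dirichlet φ (A : Mat d) (B : Mat d) := by
  have key : ∀ a ∈ J, ∀ b ∈ J, b ≤ a →
      truncPsi φ δ a - truncPsi φ δ b ≤ psi φ a - psi φ b := by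
    intro a ha b hb hab
    unfold truncPsi
    rcases le_total δ b with h1 | h1
    · rw [max_eq_left h1, max_eq_left (h1.trans hab)]
    · rw [max_eq_right h1]
      have h3 := hJ hb hδ h1
      have h4 := hJ hb ha hab
      rcases le_total δ a with h2 | h2
      · rw [max_eq_left h2]
        linarith
      · rw [max_eq_right h2]
        linarith
  refine ntr_sub_mul_sub_le A.2 B.2 hA hB fun a ha b hb => ?_
  rcases le_total b a with hab | hab
  · exact mul_le_mul_of_nonneg_left (key a ha b hb hab) (sub_nonneg.2 hab)
  · have := key b hb a ha hab
    exact mul_le_mul_of_nonpos_left (by linarith) (sub_nonpos.2 hab)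

theorem dirichlet_nonneg {J : Set ℝ} (hJ : MonotoneOn (psi φ) J) {A B : Herm d}
    (hA : spectrum ℝ (A : Mat d) ⊆ J) (hB : spectrum ℝ (B : Mat d) ⊆ J) :
    0 ≤ dirichlet φ (A : Mat d) (B : Mat d) := by
  have h := ntr_sub_mul_sub_le A.2 B.2 hA hB (f := fun _ => 0) (g := psi φ) fun a ha b hb => by
    rw [sub_self, mul_zero]
    rcases le_total b a with hab | hab
    · exact mul_nonneg (sub_nonneg.2 hab) (sub_nonneg.2 (hJ hb ha hab))
    · exact mul_nonneg_of_nonpos_of_nonpos (sub_nonpos.2 hab) (sub_nonpos.2 (hJ ha hb hab))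
  have h0 : ∀ M : Mat d, stdFun (fun _ => 0) M = 0 := fun M => cfc_const_zero ℝ M
  simpa [h0, ntr, dirichlet] using h

/-- After a shift by εI both matrices are positive definite and the comparison applies. As ε ↓ 0 the
truncated side converges by continuity, so the bound survives the liminf whether or not the true
form has a limit. -/
theorem IsRegularConvex.truncDirichlet_le_dirichletExt (h : IsRegularConvex φ) (hδ : 0 < δ)
    {A B : Herm d} (hA : A ∈ psdSet d) (hB : B ∈ psdSet d) :
    ENNReal.ofReal (truncDirichlet φ δ (A, B)) ≤ dirichletExt φ (A : Mat d) (B : Mat d) := by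
  set I : Herm d := ⟨1, IsSelfAdjoint.one _⟩ with hI
  have hcoe : ∀ (C : Herm d) (ε : ℝ), ((C + ε • I : Herm d) : Mat d) =
      (C : Mat d) + (ε : ℂ) • (1 : Mat d) := fun C ε => by
    rw [Complex.coe_smul]; rfl
  have hpd : ∀ C ∈ psdSet d, ∀ ε : ℝ, 0 < ε → C + ε • I ∈ posDefSet d := by
    intro C hC ε hε
    have h2 : ((ε • I : Herm d) : Mat d).PosDef := by
      simpa [hI] using Matrix.PosDef.smul (Matrix.PosDef.one (n := Fin d) (R := ℂ)) hε
    exact Matrix.PosDef.posSemidef_add hC h2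
  have hcont : Continuous fun ε : ℝ =>
      ENNReal.ofReal (truncDirichlet φ δ (A + ε • I, B + ε • I)) :=
    ENNReal.continuous_ofReal.comp ((h.continuous_truncDirichlet hδ).comp (by fun_prop))
  have hlim : Tendsto (fun ε : ℝ =>
      ENNReal.ofReal (truncDirichlet φ δ (A + ε • I, B + ε • I))) (𝓝[>] 0)
      (𝓝 (ENNReal.ofReal (truncDirichlet φ δ (A, B)))) := by
    simpa using (hcont.tendsto 0).mono_left nhdsWithin_le_nhds
  rw [← hlim.liminf_eq, dirichletExt]
  refine liminf_le_liminf ?_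
  filter_upwards [self_mem_nhdsWithin] with ε hε
  have hε : 0 < ε := hε
  have := truncDirichlet_le_dirichlet h.monotoneOn_psi (Set.mem_Ioi.2 hδ)
    (mem_posDefSet_iff.1 (hpd A hA ε hε)) (mem_posDefSet_iff.1 (hpd B hB ε hε))
  rw [dirichlet, hcoe, hcoe, add_sub_add_right_eq_sub] at this
  exact ENNReal.ofReal_le_ofReal this

/-! ### Resampling and the proof of the corollary. -/

/-- Resampling one coordinate preserves a product measure. -/
theorem map_update_prod_pi {S : Type*} [MeasurableSpace S] {n : ℕ} (μ : Fin n → Measure S)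
    [∀ i, IsProbabilityMeasure (μ i)] (i : Fin n) :
    ((Measure.pi μ).prod (μ i)).map
      (fun p : (Fin n → S) × S => Function.update p.1 i p.2) = Measure.pi μ := by
  refine (Measure.pi_eq fun s hs => ?_).symm
  rw [Measure.map_apply measurable_update' (MeasurableSet.univ_pi hs)]
  have e : (fun p : (Fin n → S) × S => Function.update p.1 i p.2) ⁻¹' Set.univ.pi s =
      (Set.univ.pi (Function.update s i Set.univ)) ×ˢ s i := by
    ext ⟨x, t⟩
    simp only [Set.mem_preimage, Set.mem_pi, Set.mem_univ, true_implies, Set.mem_prod]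
    constructor
    · intro H
      refine ⟨fun j => ?_, by simpa using H i⟩
      rcases eq_or_ne j i with rfl | hj
      · simp
      · simpa [Function.update_of_ne hj] using H j
    · rintro ⟨H, ht⟩ j
      rcases eq_or_ne j i with rfl | hj
      · simpa using ht
      · simpa [Function.update_of_ne hj] using H j
  rw [e, Measure.prod_prod, Measure.pi_pi]
  have e2 : ∀ j, μ j (Function.update s i Set.univ j) =
      Function.update (fun j => μ j (s j)) i 1 j := by
    intro j
    rcases eq_or_ne j i with rfl | hj
    · simp
    · simp [Function.update_of_ne hj]
  simp only [e2]
  rw [Finset.prod_update_of_mem (Finset.mem_univ i), one_mul, mul_comm,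
    ← Finset.mul_prod_erase _ (fun j => μ j (s j)) (Finset.mem_univ i),
    Finset.sdiff_singleton_eq_erase]

end MatrixEntropy

open MatrixEntropy in
theorem corollary1p3 {Ω S : Type*} [MeasurableSpace Ω] (P : Measure Ω) [IsProbabilityMeasure P]
    [TopologicalSpace S] [PolishSpace S] [MeasurableSpace S] [BorelSpace S]
    (n d : ℕ) (hd : 1 ≤ d)
    (φ : ℝ → ℝ) (hφ : MatrixEntropy.MemPhiInfty φ)
    (X X' : Fin n → Ω → S)
    (hX : ∀ i, Measurable (X i)) (hX' : ∀ i, Measurable (X' i))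
    (hindep : iIndepFun X P) (hindep' : iIndepFun X' P)
    (hcopy : ∀ i, IdentDistrib (X' i) (X i) P P)
    (hXX' : IndepFun (fun ω i => X i ω) (fun ω i => X' i ω) P)
    (F : (Fin n → S) → MatrixEntropy.Mat d)
    (hF : ∀ j k, Measurable (fun x => F x j k))
    (hpos : ∀ x, (F x).PosSemidef)
    (Z : Ω → MatrixEntropy.Mat d) (hZ : Z = fun ω => F (fun i => X i ω))
    (Z' : Fin n → Ω → MatrixEntropy.Mat d)
    (hZ' : Z' = fun i ω => F (Function.update (fun j => X j ω) i (X' i ω)))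
    (hint : Integrable (fun ω => ‖Z ω‖) P)
    (hintφ : Integrable (fun ω => ‖MatrixEntropy.stdFun φ (Z ω)‖) P) :
    ((DifferentiableWithinAt ℝ φ (Set.Ici 0) 0 ∨ ∀ᵐ ω ∂P, (Z ω).PosDef) →
      (∀ i, ∀ᵐ ω ∂P, 0 ≤ MatrixEntropy.dirichlet φ (Z ω) (Z' i ω)) ∧
      ENNReal.ofReal (MatrixEntropy.entropy φ P Z) ≤
        (1 / 2) * ∑ i, ∫⁻ ω, ENNReal.ofReal (MatrixEntropy.dirichlet φ (Z ω) (Z' i ω)) ∂P) ∧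
    ENNReal.ofReal (MatrixEntropy.entropy φ P Z) ≤
      (1 / 2) * ∑ i, ∫⁻ ω, MatrixEntropy.dirichletExt φ (Z ω) (Z' i ω) ∂P := by
  have hmem := hφ d hd
  have h := hmem.isRegularConvex
  have hpot := hmem.isEntropyPotential
  set G : (Fin n → S) → Herm d := fun x => ⟨F x, (hpos x).1⟩ with hG
  have hGK : ∀ x, G x ∈ psdSet d := hpos
  have hGm : StronglyMeasurable G := by
    refine (Embedding.comp_stronglyMeasurable_iff Topology.IsEmbedding.subtypeVal).1 ?_
    have h1 : Measurable (fun x => (fun j k => F x j k : Fin d → Fin d → ℂ)) :=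
      measurable_pi_lambda _ fun j => measurable_pi_lambda _ fun k => hF j k
    exact h1.stronglyMeasurable
  set V : Ω → Fin n → S := fun ω i => X i ω with hV
  have hVm : Measurable V := measurable_pi_lambda _ hX
  set μ : Fin n → Measure S := fun i => P.map (X i) with hμ
  have hμP : ∀ i, IsProbabilityMeasure (μ i) := fun i =>
    Measure.isProbabilityMeasure_map (hX i).aemeasurable
  have hlaw : P.map V = Measure.pi μ :=
    (iIndepFun_iff_map_fun_eq_pi_map fun i => (hX i).aemeasurable).1 hindep
  have hpair : ∀ i, P.map (fun ω => (V ω, X' i ω)) = (Measure.pi μ).prod (μ i) := fun i => by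
    have hi : IndepFun V (X' i) P := hXX'.comp measurable_id (measurable_pi_apply i)
    rw [(indepFun_iff_map_prod_eq_prod_map_map hVm.aemeasurable (hX' i).aemeasurable).1 hi, hlaw,
      (hcopy i).map_eq]
  have hpush : ∀ i (W : (Fin n → S) × S → ℝ≥0∞), Measurable W →
      ∫⁻ x, ∫⁻ s, W (x, s) ∂(μ i) ∂(Measure.pi μ) = ∫⁻ ω, W (V ω, X' i ω) ∂P := fun i W hW => by
    rw [← lintegral_prod _ hW.aemeasurable, ← hpair i, lintegral_map hW (hVm.prodMk (hX' i))]
  have hGV : Integrable (fun ω => G (V ω)) P := by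
    refine (integrable_norm_iff (hGm.comp_measurable hVm).aestronglyMeasurable).1 ?_
    rw [hZ] at hint
    exact hint
  have hfm : AEStronglyMeasurable (fun ω => trFun φ (G (V ω))) P :=
    aestronglyMeasurable_comp_of_continuousOn hpot.isClosed hpot.continuousOn
      (hGm.comp_measurable hVm).aestronglyMeasurable (Eventually.of_forall fun ω => hGK _)
  have hfGV : Integrable (fun ω => trFun φ (G (V ω))) P := by
    rw [hZ] at hintφ
    exact hintφ.mono' hfm (Eventually.of_forall fun ω => abs_ntr_le _)
  have hfm' : AEStronglyMeasurable (fun x => trFun φ (G x)) (P.map V) :=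
    aestronglyMeasurable_comp_of_continuousOn hpot.isClosed hpot.continuousOn
      hGm.aestronglyMeasurable (Eventually.of_forall hGK)
  have hGi : Integrable G (Measure.pi μ) := by
    rw [← hlaw]
    exact (integrable_map_measure hGm.aestronglyMeasurable hVm.aemeasurable).2 hGV
  have hfGi : Integrable (fun x => trFun φ (G x)) (Measure.pi μ) := by
    rw [← hlaw]
    exact (integrable_map_measure hfm' hVm.aemeasurable).2 hfGV
  have hent : entropy φ P Z =
      ∫ x, trFun φ (G x) ∂(Measure.pi μ) - trFun φ (∫ x, G x ∂(Measure.pi μ)) := by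
    rw [← hlaw, integral_map hVm.aemeasurable hfm',
      integral_map hVm.aemeasurable hGm.aestronglyMeasurable, entropy, hZ]
    have e := (selfAdjoint.submodule ℝ (Mat d)).subtypeL.integral_comp_comm hGV
    have e' : ∫ ω, F (V ω) ∂P = ((∫ ω, G (V ω) ∂P : Herm d) : Mat d) := e
    rw [e']
    rfl
  have hbound : ∀ δ : ℝ, 0 < δ → ENNReal.ofReal (entropy φ P Z) ≤
      (1 / 2) * ∑ i, ∫⁻ ω, ENNReal.ofReal (truncDirichlet φ δ
        (G (V ω), G (Function.update (V ω) i (X' i ω)))) ∂P +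
          n * ENNReal.ofReal (2 * truncError φ δ) := by
    intro δ hδ
    have hD : Continuous fun p : Herm d × Herm d => ENNReal.ofReal (truncDirichlet φ δ p / 2) :=
      ENNReal.continuous_ofReal.comp ((h.continuous_truncDirichlet hδ).div_const 2)
    have main := hpot.ofReal_entropy_pi_le hD
      (fun ν _ T hTm hTK hT hfT => h.ofReal_entropy_le hδ ν T hTm hTK hT hfT)
      n μ G hGm hGK hGi hfGi
    rw [hent]
    refine main.trans (le_of_eq ?_)
    rw [Finset.mul_sum]
    congr 1
    refine Finset.sum_congr rfl fun i _ => ?_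
    have hm : Measurable fun p : (Fin n → S) × S => ENNReal.ofReal (truncDirichlet φ δ
        (G p.1, G (Function.update p.1 i p.2))) :=
      ((ENNReal.continuous_ofReal.comp
        (h.continuous_truncDirichlet hδ)).comp_stronglyMeasurable
          ((hGm.comp_measurable measurable_fst).prodMk
            (hGm.comp_measurable measurable_update'))).measurable
    have hhalf : ∀ t : ℝ, ENNReal.ofReal (t / 2) = (1 / 2) * ENNReal.ofReal t := fun t => by
      rw [div_eq_inv_mul, ENNReal.ofReal_mul (by norm_num), ENNReal.ofReal_inv_of_pos two_pos,
        ENNReal.ofReal_ofNat, one_div]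
    simp only [hhalf]
    rw [hpush i _ (hm.const_mul _)]
    exact lintegral_const_mul _ (hm.comp (hVm.prodMk (hX' i)))
  -- Any `R` dominating all the truncated forms bounds the entropy once δ ↓ 0. Both (a) and (b) are
  -- instances; measurability of `R` is not needed, since lower integrals are monotone.
  have hlimit : ∀ R : Fin n → Ω → ℝ≥0∞, (∀ δ : ℝ, 0 < δ → ∀ i, ∀ᵐ ω ∂P,
      ENNReal.ofReal (truncDirichlet φ δ
        (G (V ω), G (Function.update (V ω) i (X' i ω)))) ≤ R i ω) →
      ENNReal.ofReal (entropy φ P Z) ≤ (1 / 2) * ∑ i, ∫⁻ ω, R i ω ∂P := by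
    intro R hR
    have hlim : Tendsto (fun δ => (1 / 2) * ∑ i, ∫⁻ ω, R i ω ∂P +
        n * ENNReal.ofReal (2 * truncError φ δ)) (𝓝[>] 0)
        (𝓝 ((1 / 2) * ∑ i, ∫⁻ ω, R i ω ∂P)) := by
      have h1 : Tendsto (fun δ => (n : ℝ≥0∞) * ENNReal.ofReal (2 * truncError φ δ)) (𝓝[>] 0)
          (𝓝 0) := by
        have h2 := ENNReal.tendsto_ofReal (h.tendsto_truncError.const_mul 2)
        simpa using ENNReal.Tendsto.const_mul h2 (Or.inr (ENNReal.natCast_ne_top n))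
      simpa using h1.const_add ((1 / 2) * ∑ i, ∫⁻ ω, R i ω ∂P)
    refine ge_of_tendsto hlim ?_
    filter_upwards [self_mem_nhdsWithin] with δ hδ
    exact (hbound δ hδ).trans (add_le_add (mul_le_mul' le_rfl
      (Finset.sum_le_sum fun i _ => lintegral_mono_ae (hR δ hδ i))) le_rfl)
  -- Z'ᵢ has the law of Z, so almost sure positive definiteness passes from Z to Z'ᵢ.
  have hresample : ∀ i, P.map (fun ω => Function.update (V ω) i (X' i ω)) = Measure.pi μ :=
    fun i => by
      rw [← map_update_prod_pi μ i, ← hpair i,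
        Measure.map_map measurable_update' (hVm.prodMk (hX' i))]
      rfl
  refine ⟨fun hcase => ?_, ?_⟩
  -- `J` is a set on which ψ is monotone and which almost surely contains the spectra of Z and Z'ᵢ:
  -- [0, ∞) if φ'(0) is finite, (0, ∞) if Z is positive definite.
  · obtain ⟨J, hJ, hJpos, hJZ, hJZ'⟩ : ∃ J : Set ℝ, MonotoneOn (psi φ) J ∧ Set.Ioi 0 ⊆ J ∧
        (∀ᵐ ω ∂P, spectrum ℝ (G (V ω) : Mat d) ⊆ J) ∧
        ∀ i, ∀ᵐ ω ∂P, spectrum ℝ (G (Function.update (V ω) i (X' i ω)) : Mat d) ⊆ J := by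
      rcases hcase with h0 | hpd
      · refine ⟨Set.Ici 0, ?_, Set.Ioi_subset_Ici_self, ?_, fun i => ?_⟩
        · refine h.convexOn.monotoneOn_derivWithin fun t ht => ?_
          rcases (Set.mem_Ici.1 ht).eq_or_lt with rfl | ht
          · exact h0
          · exact (h.hasDerivAt ht).differentiableAt.differentiableWithinAt
        · exact Eventually.of_forall fun ω t ht => spectrum_nonneg (hpos _) ht
        · exact Eventually.of_forall fun ω t ht => spectrum_nonneg (hpos _) ht
      · have hset : MeasurableSet {x | G x ∈ posDefSet d} := by
          borelize (Herm d)
          exact hGm.measurable isOpen_posDefSet.measurableSet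
        have h1 : ∀ᵐ ω ∂P, G (V ω) ∈ posDefSet d := by
          rw [hZ] at hpd
          exact hpd
        have h2 : ∀ᵐ x ∂(Measure.pi μ), G x ∈ posDefSet d := by
          rw [← hlaw]
          exact (ae_map_iff hVm.aemeasurable hset).2 h1
        refine ⟨Set.Ioi 0, h.monotoneOn_psi, subset_rfl, ?_, fun i => ?_⟩
        · exact h1.mono fun ω hω => mem_posDefSet_iff.1 hω
        · rw [← hresample i] at h2
          exact (ae_of_ae_map (measurable_update'.comp
            (hVm.prodMk (hX' i))).aemeasurable h2).mono fun ω hω => mem_posDefSet_iff.1 hω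
    have hnonneg : ∀ i, ∀ᵐ ω ∂P, 0 ≤ dirichlet φ (G (V ω) : Mat d)
        (G (Function.update (V ω) i (X' i ω)) : Mat d) := fun i => by
      filter_upwards [hJZ, hJZ' i] with ω h1 h2 using dirichlet_nonneg hJ h1 h2
    have hle := hlimit (fun i ω => ENNReal.ofReal (dirichlet φ (G (V ω) : Mat d)
        (G (Function.update (V ω) i (X' i ω)) : Mat d))) fun δ hδ i => by
      filter_upwards [hJZ, hJZ' i] with ω h1 h2
      exact ENNReal.ofReal_le_ofReal (truncDirichlet_le_dirichlet hJ (hJpos hδ) h1 h2)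
    rw [hZ']
    rw [hZ] at hle ⊢
    exact ⟨hnonneg, hle⟩
  · rw [hZ']
    have := hlimit (fun i ω => dirichletExt φ (G (V ω) : Mat d)
        (G (Function.update (V ω) i (X' i ω)) : Mat d)) fun δ hδ i =>
      Eventually.of_forall fun ω => h.truncDirichlet_le_dirichletExt hδ (hGK _) (hGK _)
    rw [hZ] at this ⊢
    exact this
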